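/- Let $X_1,X_2,\dots$ be i.i.d. real-valued random variables with distribution $F$, let $m\ge 1$, and let $h:\mathbb{R}^m\to\mathbb{R}$ be a Borel-measurable kernel that is symmetric in its arguments. Put $\theta=\int\cdots\int h(x_1,\dots,x_m)\,dF(x_1)\cdots dF(x_m)$, $\tilde h_1(x)=\mathbb{E}(h(X_1,\dots,X_m)-\theta\mid X_1=x)$, $V_n=\big(\sum_{i=1}^n\tilde h_1^2(X_i)\big)^{1/2}$, and for $k\ge m$ let $$U_k=\binom{k}{m}^{-1}\sum_{1\le i_1<\cdots<i_m\le k}h(X_{i_1},\dots,X_{i_m}).$$ For $0\le t\le 1$ let $U^*_{[nt]}=0$ if $t<m/n$ and $U^*_{[nt]}=(U_{[nt]}-\theta)/V_n$ if $t\ge m/n$, where $[\cdot]$ is the greatest integer function. Assume that $\mathbb{E}\big(|h(X_1,\dots,X_m)|^{4/3}\log|h(X_1,\dots,X_m)|\big)<\infty$ and that $\tilde h_1(X_1)$ is in the domain of attraction of the normal law, that is, there are constants $A_n$ and $B_n>0$ such that $$\frac{\sum_{i=1}^n\tilde h_1(X_i)-A_n}{B_n}\longrightarrow_d N(0,1)\quad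 (n\to\infty). \qquad (*)$$ Then, as $n\to\infty$, $$\sup_{0\le t\le1}\Big|\frac{[nt]}{m}U^*_{[nt]}-\frac{\sum_{i=1}^{[nt]}\tilde h_1(X_i)}{V_n}\Big|=o_P(1),\qquad (1)$$ and, for all constants $A_n$ and $B_n>0$ that satisfy $(*)$, $$\sup_{0\le t\le1}\Big|\frac{[nt]}{m}\,\frac{U_{[nt]}-\theta}{B_n}-\frac{\sum_{i=1}^{[nt]}\tilde h_1(X_i)}{B_n}\Big|=o_P(1),\qquad (2)$$ where in (2) the term $(U_{[nt]}-\theta)/B_n$ is read as $0$ for $t<m/n$. -/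

import Mathlib

open MeasureTheory ProbabilityTheory Filter Topology

noncomputable section

namespace UStatistic

variable {Ω : Type*} [MeasurableSpace Ω]

/-- `S_n = Y_1 + ⋯ + Y_n`, where the sequence `Y_1, Y_2, …` is stored as `Y 0, Y 1, …`. -/
def partialSum (Y : ℕ → Ω → ℝ) (n : ℕ) (ω : Ω) : ℝ :=
  ∑ i ∈ Finset.range n, Y i ω

/-- `A` and `B` are centering and norming constants for the sequence `Y`: `B_n > 0` for `n ≥ 1` and
`(Y_1 + ⋯ + Y_n - A_n) / B_n` converges in distribution to `N(0, 1)`. -/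
def IsNormalNorming (P : Measure Ω) [IsProbabilityMeasure P] (Y : ℕ → Ω → ℝ)
    (A B : ℕ → ℝ) : Prop :=
  (∀ n, 1 ≤ n → 0 < B n) ∧
    TendstoInDistribution (fun n ω => (partialSum Y n ω - A n) / B n) atTop
      (id : ℝ → ℝ) (fun _ => P) (gaussianReal 0 1)

/-- The i.i.d. sequence `Y` is in the domain of attraction of the normal law. -/
def InDAN (P : Measure Ω) [IsProbabilityMeasure P] (Y : ℕ → Ω → ℝ) : Prop :=
  ∃ A B : ℕ → ℝ, IsNormalNorming P Y A B

/-- The parameter `θ = ∫ ⋯ ∫ h(x_1, …, x_m) dF(x_1) ⋯ dF(x_m)`, with `F` the law of `X_1`. -/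
def theta (P : Measure Ω) (X : ℕ → Ω → ℝ) {m : ℕ} (h : (Fin m → ℝ) → ℝ) : ℝ :=
  ∫ x, h x ∂(Measure.pi fun _ : Fin m => P.map (X 0))

/-- `h̃₁(x) = E(h(X_1, …, X_m) - θ | X_1 = x)`, the integral of `h - θ` with respect to the regular
conditional distribution of `(X_1, …, X_m)` given `X_1 = x`. -/
def proj (P : Measure Ω) [IsProbabilityMeasure P] (X : ℕ → Ω → ℝ) {m : ℕ}
    (h : (Fin m → ℝ) → ℝ) (x : ℝ) : ℝ :=
  ∫ y, (h y - theta P X h) ∂(condDistrib (fun ω (j : Fin m) => X j ω) (X 0) P x)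

open Classical in
/-- The U-statistic `U_k = (k choose m)⁻¹ ∑_{i_1 < ⋯ < i_m ≤ k} h(X_{i_1}, …, X_{i_m})`. -/
def uStat (X : ℕ → Ω → ℝ) {m : ℕ} (h : (Fin m → ℝ) → ℝ) (k : ℕ) (ω : Ω) : ℝ :=
  ((k.choose m : ℕ) : ℝ)⁻¹ *
    ∑ i ∈ Finset.univ.filter (fun i : Fin m → Fin k => StrictMono i),
      h (fun j => X (i j) ω)

/-- The self-normalizer `V_n = (∑_{i ≤ n} h̃₁(X_i)²)^{1/2}`. -/
def selfNorm (P : Measure Ω) [IsProbabilityMeasure P] (X : ℕ → Ω → ℝ) {m : ℕ}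
    (h : (Fin m → ℝ) → ℝ) (n : ℕ) (ω : Ω) : ℝ :=
  √(∑ i ∈ Finset.range n, proj P X h (X i ω) ^ 2)

/-- The U-process with normalizer `c`, at time `t ∈ [0, 1]`: it is `0` for `t < m / n` and
`(U_{[nt]} - θ) / c` for `t ≥ m / n`. With `c = V_n` it is the pseudo-self-normalized U-process
`U*_{[nt]}`. -/
def uProc (P : Measure Ω) (X : ℕ → Ω → ℝ) {m : ℕ} (h : (Fin m → ℝ) → ℝ)
    (c : ℝ) (n : ℕ) (t : ℝ) (ω : Ω) : ℝ :=
  if t < (m : ℝ) / n then 0 else (uStat X h ⌊n * t⌋₊ ω - theta P X h) / c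

/-- `sup_{0 ≤ t ≤ 1} |([nt] / m) (U-process at t with normalizer c) - ∑_{i ≤ [nt]} h̃₁(X_i) / c|`.
For fixed `n` and `ω` only finitely many values occur, so this is a genuine supremum. -/
def supDist (P : Measure Ω) [IsProbabilityMeasure P] (X : ℕ → Ω → ℝ) {m : ℕ}
    (h : (Fin m → ℝ) → ℝ) (c : ℝ) (n : ℕ) (ω : Ω) : ℝ :=
  ⨆ t : Set.Icc (0 : ℝ) 1,
    |(⌊n * (t : ℝ)⌋₊ : ℝ) / m * uProc P X h c n t ω
      - partialSum (fun i ω => proj P X h (X i ω)) ⌊n * (t : ℝ)⌋₊ ω / c|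

end UStatistic

end

/-!
Write `p = h̃₁`, `F` for the law of the observations, and
`g(x) = h(x) - θ - ∑ⱼ p(xⱼ)`. Then `(k / m) (U_k - θ) - ∑_{i ≤ k} p(Xᵢ) = (k / m) U_k(g)`, and `g` is
degenerate: its conditional mean given any one argument vanishes. So everything follows from two
facts.

* `max_{m ≤ k ≤ n} k |U_k(g)| = o_P(√n)` (`tendsto_measure_exists_le_abs_tupleAvg`).
  By exchangeability, `U_k(g)` is the average of its leave-one-out versions, hence a reverse
  martingale. This gives a Hájek–Rényi inequality (`mul_measure_exists_le_sum`), which bounds the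
  probability that the maximum exceeds `b √n` by `(m E|U_m(g)| + ∑_{m < k ≤ n} E|U_k(g)|) / (b √n)`.
  It remains to see that `E|U_k(g)| = o(k ^ (-1 / 2))`
  (`tendsto_sqrt_mul_integral_abs_tupleAvg`). Split `h` at the level `k ^ (3 / 2)`. The large part
  contributes at most a multiple of
  `E |h| 1(|h| > k ^ (3 / 2)) ≤ k ^ (-1 / 2) E |h| ^ (4 / 3) 1(|h| > k ^ (3 / 2))`. For the small
  part `a`, degeneracy removes all covariances between tuples with fewer than two common indices,
  so the second moment is `O(k ^ (-2)) E a ^ 2 = o(k ^ (-1))`, since `E a ^ 2 = o(k)` by dominated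
  convergence. Taking the first moments at each `k` separately, with a truncation level depending
  on `k`, makes `E |h| ^ (4 / 3) < ∞` sufficient.

* The normalizers are at least of order `√n`. For `B_n` (`IsNormalNorming.exists_sqrt_le`) this is
  a comparison of characteristic functions: tightness of the normed sums keeps `|φ(s)| ^ n` above
  `1 / 2` at some `s` of order `1 / B_n`, while `|φ(s)| ^ 2 ≤ 1 - c s ^ 2` near the origin. For `V_n`
  (`exists_tendsto_measure_sqrt_sum_sq_lt`) it is the law of large numbers for the truncated squares
  `min(p(Xᵢ) ^ 2, 1)`. Both use that `p(X₁)` is not almost surely constant, which asymptotic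
  normality implies.
-/

namespace UStatistic

/-! ### Averages over injective index tuples -/

/-- The injective `m`-tuples of indices with entries in `S`. -/
def injTuples (m : ℕ) (S : Finset ℕ) : Finset (Fin m → ℕ) :=
  (Fintype.piFinset fun _ => S).filter Function.Injective

lemma mem_injTuples {m : ℕ} {S : Finset ℕ} {i : Fin m → ℕ} :
    i ∈ injTuples m S ↔ (∀ j, i j ∈ S) ∧ Function.Injective i := by
  simp [injTuples]

lemma card_injTuples (m : ℕ) (S : Finset ℕ) :
    (injTuples m S).card = S.card.descFactorial m := by
  have h := Fintype.card_embedding_eq (α := Fin m) (β := S)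
  rw [Fintype.card_fin, Fintype.card_coe] at h
  rw [← h, ← Finset.card_univ]
  symm
  refine Finset.card_bij (fun e _ j => ((e j : S) : ℕ)) ?_ ?_ ?_
  · intro e _
    exact mem_injTuples.2 ⟨fun j => (e j).2, Subtype.val_injective.comp e.injective⟩
  · intro e _ e' _ h
    ext j
    exact congrFun h j
  · intro i hi
    rw [mem_injTuples] at hi
    exact ⟨⟨fun j => ⟨i j, hi.1 j⟩, fun a b hab => hi.2 (congrArg Subtype.val hab)⟩,
      Finset.mem_univ _, rfl⟩

/-- The U-statistic of the kernel `g` on the observations `x l`, `l ∈ S`, as an average over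
ordered tuples of distinct indices. It makes sense without symmetry of `g`, and the set `S` of
indices is arbitrary, so that permutations of the observations act on it. -/
noncomputable def tupleAvg {m : ℕ} (g : (Fin m → ℝ) → ℝ) (S : Finset ℕ) (x : ℕ → ℝ) : ℝ :=
  ((S.card.descFactorial m : ℕ) : ℝ)⁻¹ * ∑ i ∈ injTuples m S, g (fun j => x (i j))

lemma tupleAvg_comp_perm {m : ℕ} (g : (Fin m → ℝ) → ℝ) (S : Finset ℕ) (x : ℕ → ℝ)
    (σ : Equiv.Perm ℕ) :
    tupleAvg g S (fun l => x (σ l)) = tupleAvg g (S.map σ.toEmbedding) x := by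
  unfold tupleAvg
  rw [Finset.card_map]
  congr 1
  refine Finset.sum_equiv (Equiv.arrowCongr (Equiv.refl _) σ) ?_ ?_
  · intro i
    simp [mem_injTuples, Equiv.arrowCongr]
  · intro i _
    simp [Equiv.arrowCongr]

lemma sum_injTuples_erase {m : ℕ} (f : (Fin m → ℕ) → ℝ) (S : Finset ℕ) (hm : m ≤ S.card) :
    ∑ l ∈ S, ∑ i ∈ injTuples m (S.erase l), f i =
      ((S.card : ℝ) - m) * ∑ i ∈ injTuples m S, f i := by
  have h1 : ∀ l ∈ S, ∑ i ∈ injTuples m (S.erase l), f i =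
      ∑ i ∈ injTuples m S, if l ∉ Finset.univ.image i then f i else 0 := by
    intro l _
    rw [← Finset.sum_filter]
    refine Finset.sum_congr ?_ fun _ _ => rfl
    ext i
    simp only [mem_injTuples, Finset.mem_erase, Finset.mem_filter, Finset.mem_image,
      Finset.mem_univ, true_and, not_exists]
    constructor
    · exact fun h => ⟨⟨fun j => (h.1 j).2, h.2⟩, fun j => (h.1 j).1⟩
    · exact fun h => ⟨fun j => ⟨h.2 j, h.1.1 j⟩, h.1.2⟩
  rw [Finset.sum_congr rfl h1, Finset.sum_comm, Finset.mul_sum]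
  refine Finset.sum_congr rfl fun i hi => ?_
  rw [mem_injTuples] at hi
  rw [← Finset.sum_filter, Finset.sum_const, nsmul_eq_mul]
  congr 1
  have h2 : S.filter (fun l => l ∉ Finset.univ.image i) = S \ Finset.univ.image i := by
    ext l; simp
  have h3 : Finset.univ.image i ⊆ S := by
    intro l hl
    obtain ⟨j, _, rfl⟩ := Finset.mem_image.1 hl
    exact hi.1 j
  rw [h2, Finset.card_sdiff_of_subset h3, Finset.card_image_of_injective _ hi.2,
    Finset.card_univ, Fintype.card_fin, Nat.cast_sub hm]

/-- A U-statistic is the average of its leave-one-out versions. -/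
lemma sum_tupleAvg_erase {m : ℕ} (g : (Fin m → ℝ) → ℝ) (S : Finset ℕ) (x : ℕ → ℝ)
    (hm : m < S.card) :
    ∑ l ∈ S, tupleAvg g (S.erase l) x = S.card * tupleAvg g S x := by
  unfold tupleAvg
  have h1 : ∀ l ∈ S, (((S.erase l).card.descFactorial m : ℕ) : ℝ)⁻¹ *
      ∑ i ∈ injTuples m (S.erase l), g (fun j => x (i j)) =
      (((S.card - 1).descFactorial m : ℕ) : ℝ)⁻¹ *
      ∑ i ∈ injTuples m (S.erase l), g (fun j => x (i j)) := by
    intro l hl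
    rw [Finset.card_erase_of_mem hl]
  rw [Finset.sum_congr rfl h1, ← Finset.mul_sum, sum_injTuples_erase _ _ hm.le]
  obtain ⟨k, hk⟩ : ∃ k, S.card = k + 1 := ⟨S.card - 1, by omega⟩
  rw [hk] at hm ⊢
  have h2 : (k + 1) * k.descFactorial m = (k + 1 - m) * (k + 1).descFactorial m := by
    rw [← Nat.succ_descFactorial_succ, Nat.descFactorial_succ]
  have h3 : ((k : ℝ) + 1) * (k.descFactorial m : ℕ) = ((k : ℝ) + 1 - m) *
      ((k + 1).descFactorial m : ℕ) := by
    have := congrArg (Nat.cast : ℕ → ℝ) h2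
    rw [Nat.cast_mul, Nat.cast_mul, Nat.cast_sub hm.le] at this
    exact_mod_cast this
  have h4 : ((k.descFactorial m : ℕ) : ℝ) ≠ 0 := by
    exact_mod_cast (Nat.descFactorial_eq_zero_iff_lt.not.2 (by omega))
  have h5 : (((k + 1).descFactorial m : ℕ) : ℝ) ≠ 0 := by
    exact_mod_cast (Nat.descFactorial_eq_zero_iff_lt.not.2 (by omega))
  rw [← mul_assoc, ← mul_assoc]
  congr 1
  simp only [Nat.add_sub_cancel]
  field_simp
  push_cast
  linarith

lemma sum_injTuples_apply {m : ℕ} (p : ℕ → ℝ) (k : ℕ) (hk : 0 < k) (j : Fin m) :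
    ∑ i ∈ injTuples m (Finset.range k), p (i j) =
      ((k.descFactorial m : ℕ) : ℝ) / k * ∑ l ∈ Finset.range k, p l := by
  -- the number of tuples with a given `j`-th entry does not depend on the entry
  have hN : ∀ l ∈ Finset.range k,
      ((injTuples m (Finset.range k)).filter (fun i => i j = l)).card =
      ((injTuples m (Finset.range k)).filter (fun i => i j = 0)).card := by
    intro l hl
    have hmem : ∀ a, Equiv.swap l 0 a ∈ Finset.range k ↔ a ∈ Finset.range k := by
      intro a
      rw [Finset.mem_range] at hl
      rw [Equiv.swap_apply_def]
      split_ifs with h1 h2 <;> simp_all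
    refine Finset.card_equiv (Equiv.arrowCongr (Equiv.refl _) (Equiv.swap l 0)) ?_
    intro i
    have hinj : Function.Injective (fun a => Equiv.swap l 0 (i a)) ↔ Function.Injective i :=
      Equiv.comp_injective i (Equiv.swap l 0)
    have harr : (Equiv.arrowCongr (Equiv.refl (Fin m)) (Equiv.swap l 0)) i =
      fun a => Equiv.swap l 0 (i a) := rfl
    simp only [Finset.mem_filter, mem_injTuples, harr, hmem, hinj, Equiv.swap_apply_eq_iff,
      Equiv.swap_apply_right]
  have hfib : ∀ f : ℕ → ℝ, ∑ i ∈ injTuples m (Finset.range k), f (i j) =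
      (((injTuples m (Finset.range k)).filter (fun i => i j = 0)).card : ℝ) *
        ∑ l ∈ Finset.range k, f l := by
    intro f
    rw [← Finset.sum_fiberwise_of_maps_to (g := fun i : Fin m → ℕ => i j)
      (t := Finset.range k) (fun i hi => (mem_injTuples.1 hi).1 j), Finset.mul_sum]
    refine Finset.sum_congr rfl fun l hl => ?_
    rw [Finset.sum_congr rfl (g := fun _ => f l)
      (fun i hi => by rw [(Finset.mem_filter.1 hi).2]), Finset.sum_const, hN l hl, nsmul_eq_mul]
  have h1 := hfib fun _ => 1
  simp only [Finset.sum_const, card_injTuples, Finset.card_range, nsmul_eq_mul, mul_one] at h1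
  have hk' : (k : ℝ) ≠ 0 := by positivity
  rw [hfib, h1]
  field_simp

open Classical in
/-- Each injective tuple is a strictly increasing tuple, permuted in a unique way. -/
lemma sum_injTuples_eq_factorial_mul {m : ℕ} {h : (Fin m → ℝ) → ℝ}
    (h_symm : ∀ (σ : Equiv.Perm (Fin m)) (x : Fin m → ℝ), h (x ∘ σ) = h x) (x : ℕ → ℝ) (k : ℕ) :
    ∑ i ∈ injTuples m (Finset.range k), h (fun j => x (i j)) = (m.factorial : ℝ) *
      ∑ i ∈ Finset.univ.filter (fun i : Fin m → Fin k => StrictMono i),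
        h (fun j => x (i j)) := by
  have h1 : (m.factorial : ℝ) * ∑ i ∈ Finset.univ.filter (fun i : Fin m → Fin k => StrictMono i),
        h (fun j => x (i j)) = ∑ q ∈ (Finset.univ : Finset (Equiv.Perm (Fin m))) ×ˢ
          Finset.univ.filter (fun i : Fin m → Fin k => StrictMono i),
          h (fun j => x (q.2 j)) := by
    rw [Finset.sum_product]
    simp only [Finset.sum_const, Finset.card_univ, Fintype.card_perm, Fintype.card_fin,
      nsmul_eq_mul]
  rw [h1]
  symm
  refine Finset.sum_bij (fun q _ j => ((q.2 (q.1 j) : Fin k) : ℕ)) ?_ ?_ ?_ ?_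
  · rintro ⟨σ, i⟩ hq
    simp only [Finset.mem_product, Finset.mem_univ, Finset.mem_filter, true_and] at hq
    exact mem_injTuples.2 ⟨fun j => Finset.mem_range.2 (i (σ j)).2,
      (Fin.val_injective.comp hq.injective).comp σ.injective⟩
  · rintro ⟨σ, i⟩ hq ⟨τ, i'⟩ hq' heq
    simp only [Finset.mem_product, Finset.mem_univ, Finset.mem_filter, true_and] at hq hq'
    have heq' : i ∘ σ = i' ∘ τ := by
      funext j
      exact Fin.ext (congrFun heq j)
    have e1 : (i ∘ σ) ∘ σ.symm = i := by ext; simp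
    have e2 : (i' ∘ τ) ∘ τ.symm = i' := by ext; simp
    have hu := Tuple.unique_monotone (f := i ∘ σ) (σ := σ.symm) (τ := τ.symm)
      (by rw [e1]; exact hq.monotone) (by rw [heq', e2]; exact hq'.monotone)
    have hi : i = i' := by rw [← e1, hu, heq', e2]
    subst hi
    have hσ : σ = τ := by
      ext j
      exact congrArg Fin.val (hq.injective (congrFun heq' j))
    rw [hσ]
  · intro i hi
    rw [mem_injTuples] at hi
    let i' : Fin m → Fin k := fun j => ⟨i j, Finset.mem_range.1 (hi.1 j)⟩
    have hinj : Function.Injective i' := fun a b hab => hi.2 (congrArg Fin.val hab)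
    refine ⟨((Tuple.sort i').symm, i' ∘ Tuple.sort i'), ?_, ?_⟩
    · simp only [Finset.mem_product, Finset.mem_univ, Finset.mem_filter, true_and]
      exact (Tuple.monotone_sort i').strictMono_of_injective
        (hinj.comp (Tuple.sort i').injective)
    · funext j
      simp [i']
  · rintro ⟨σ, i⟩ _
    exact (h_symm σ (fun j => x (i j))).symm

lemma uStat_eq_tupleAvg {Ω : Type*} [MeasurableSpace Ω] (X : ℕ → Ω → ℝ) {m : ℕ}
    {h : (Fin m → ℝ) → ℝ}
    (h_symm : ∀ (σ : Equiv.Perm (Fin m)) (x : Fin m → ℝ), h (x ∘ σ) = h x) (k : ℕ) (ω : Ω) :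
    uStat X h k ω = tupleAvg h (Finset.range k) (fun l => X l ω) := by
  unfold uStat tupleAvg
  rw [sum_injTuples_eq_factorial_mul h_symm (fun l => X l ω), Finset.card_range,
    Nat.descFactorial_eq_factorial_mul_choose, ← mul_assoc]
  congr 1
  have : (m.factorial : ℝ) ≠ 0 := by positivity
  rw [Nat.cast_mul, mul_inv, mul_comm, ← mul_assoc, mul_inv_cancel₀ this, one_mul]

/-- Subtracting from a kernel its mean and its linear part subtracts from the U-statistic its mean
and `m / k` times the sum of the linear parts. -/
lemma tupleAvg_sub_linear {m : ℕ} (h : (Fin m → ℝ) → ℝ) (c : ℝ) (p : ℝ → ℝ) (x : ℕ → ℝ)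
    {k : ℕ} (hm : 0 < m) (hk : m ≤ k) :
    tupleAvg (fun y => h y - c - ∑ j, p (y j)) (Finset.range k) x =
      tupleAvg h (Finset.range k) x - c - (m : ℝ) / k * ∑ l ∈ Finset.range k, p (x l) := by
  have h4 : ((k.descFactorial m : ℕ) : ℝ) ≠ 0 := by
    exact_mod_cast (Nat.descFactorial_eq_zero_iff_lt.not.2 (by omega))
  have hk' : (k : ℝ) ≠ 0 := by exact_mod_cast (show k ≠ 0 by omega)
  unfold tupleAvg
  rw [Finset.sum_sub_distrib, Finset.sum_sub_distrib, Finset.sum_comm (s := injTuples m _)]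
  simp_rw [sum_injTuples_apply (fun l => p (x l)) k (by omega)]
  rw [Finset.sum_const, Finset.sum_const, card_injTuples, Finset.card_univ, Fintype.card_fin,
    Finset.card_range, nsmul_eq_mul, nsmul_eq_mul]
  field_simp

lemma tupleAvg_add {m : ℕ} (g g' : (Fin m → ℝ) → ℝ) (S : Finset ℕ) (x : ℕ → ℝ) :
    tupleAvg (fun y => g y + g' y) S x = tupleAvg g S x + tupleAvg g' S x := by
  unfold tupleAvg
  rw [Finset.sum_add_distrib, mul_add]

/-! ### A maximal inequality for U-statistics of exchangeable observations -/

lemma measurable_tupleAvg {m : ℕ} {g : (Fin m → ℝ) → ℝ} (hg : Measurable g) (S : Finset ℕ) :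
    Measurable (tupleAvg g S) := by
  unfold tupleAvg
  fun_prop

lemma integrable_tupleAvg {m : ℕ} {g : (Fin m → ℝ) → ℝ} {μ : Measure (ℕ → ℝ)}
    (hint : ∀ i : Fin m → ℕ, Function.Injective i → Integrable (fun x => g (fun j => x (i j))) μ)
    (S : Finset ℕ) : Integrable (tupleAvg g S) μ := by
  unfold tupleAvg
  exact (integrable_finsetSum _ fun i hi => hint i (mem_injTuples.1 hi).2).const_mul _

lemma tupleAvg_range_comp_perm {m : ℕ} (g : (Fin m → ℝ) → ℝ) {k : ℕ} {σ : Equiv.Perm ℕ}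
    (hσ : ∀ l, k ≤ l → σ l = l) (x : ℕ → ℝ) :
    tupleAvg g (Finset.range k) (fun l => x (σ l)) = tupleAvg g (Finset.range k) x := by
  rw [tupleAvg_comp_perm]
  congr 1
  ext l
  simp only [Finset.mem_map_equiv, Finset.mem_range]
  by_contra hcon
  have h1 : ∀ a, k ≤ a ↔ k ≤ σ.symm a := by
    intro a
    constructor
    · intro ha
      rwa [σ.symm_apply_eq.2 (hσ a ha).symm]
    · intro ha
      have := hσ _ ha
      rw [σ.apply_symm_apply] at this
      rwa [this]
  have := h1 l
  omega

/-- On an event that does not change when the first `k + 1` observations are permuted, the absolute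
moment of the U-statistics decreases from time `k` to time `k + 1`. This is the form in which it is
used that U-statistics are reverse martingales. -/
lemma setIntegral_abs_tupleAvg_succ_le {m : ℕ} {g : (Fin m → ℝ) → ℝ} (hg : Measurable g)
    {μ : Measure (ℕ → ℝ)}
    (hμ : ∀ σ : Equiv.Perm ℕ, MeasurePreserving (fun (x : ℕ → ℝ) l => x (σ l)) μ μ)
    (hint : ∀ i : Fin m → ℕ, Function.Injective i → Integrable (fun x => g (fun j => x (i j))) μ)
    {k : ℕ} (hk : m ≤ k) {D : Set (ℕ → ℝ)} (hD : MeasurableSet D)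
    (hDσ : ∀ l < k + 1, ∀ x : ℕ → ℝ, (fun a => x (Equiv.swap l k a)) ∈ D ↔ x ∈ D) :
    ∫ x in D, |tupleAvg g (Finset.range (k + 1)) x| ∂μ ≤
      ∫ x in D, |tupleAvg g (Finset.range k) x| ∂μ := by
  have hW : ∀ S, Integrable (fun x => |tupleAvg g S x|) μ := fun S =>
    (integrable_tupleAvg hint S).abs
  -- leaving out the `l`-th observation amounts to exchanging it with the last one
  have hswap : ∀ l ∈ Finset.range (k + 1), ∀ x : ℕ → ℝ,
      tupleAvg g ((Finset.range (k + 1)).erase l) x =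
        tupleAvg g (Finset.range k) (fun a => x (Equiv.swap l k a)) := by
    intro l hl x
    rw [tupleAvg_comp_perm]
    congr 1
    ext a
    simp only [Finset.mem_erase, Finset.mem_range, Finset.mem_map_equiv, Equiv.symm_swap]
    rw [Finset.mem_range] at hl
    rw [Equiv.swap_apply_def]
    split_ifs <;> omega
  have heq : ∀ l ∈ Finset.range (k + 1),
      ∫ x in D, |tupleAvg g ((Finset.range (k + 1)).erase l) x| ∂μ =
        ∫ x in D, |tupleAvg g (Finset.range k) x| ∂μ := by
    intro l hl
    rw [← integral_indicator hD, ← integral_indicator hD]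
    have hmeas : Measurable (D.indicator fun x => |tupleAvg g (Finset.range k) x|) :=
      (measurable_tupleAvg hg _).abs.indicator hD
    conv_rhs => rw [← (hμ (Equiv.swap l k)).map_eq]
    rw [integral_map (hμ _).measurable.aemeasurable hmeas.aestronglyMeasurable]
    refine integral_congr_ae (ae_of_all _ fun x => ?_)
    have h1 := hDσ l (Finset.mem_range.1 hl) x
    by_cases hx : x ∈ D
    · simp only [Set.indicator_of_mem hx, Set.indicator_of_mem (h1.2 hx), hswap l hl]
    · simp only [Set.indicator_of_notMem hx, Set.indicator_of_notMem (fun h => hx (h1.1 h))]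
  have hpt : ∀ x, |tupleAvg g (Finset.range (k + 1)) x| ≤ ((k : ℝ) + 1)⁻¹ *
      ∑ l ∈ Finset.range (k + 1), |tupleAvg g ((Finset.range (k + 1)).erase l) x| := by
    intro x
    have h1 := sum_tupleAvg_erase g (Finset.range (k + 1)) x (by simpa using Nat.lt_succ_of_le hk)
    rw [Finset.card_range] at h1
    push_cast at h1
    have h2 : tupleAvg g (Finset.range (k + 1)) x = ((k : ℝ) + 1)⁻¹ *
        ∑ l ∈ Finset.range (k + 1), tupleAvg g ((Finset.range (k + 1)).erase l) x := by
      rw [h1]; field_simp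
    rw [h2, abs_mul, abs_of_pos (by positivity : (0 : ℝ) < ((k : ℝ) + 1)⁻¹)]
    gcongr
    exact Finset.abs_sum_le_sum_abs _ _
  calc ∫ x in D, |tupleAvg g (Finset.range (k + 1)) x| ∂μ
      ≤ ∫ x in D, ((k : ℝ) + 1)⁻¹ *
        ∑ l ∈ Finset.range (k + 1), |tupleAvg g ((Finset.range (k + 1)).erase l) x| ∂μ :=
        setIntegral_mono (hW _).integrableOn
          ((integrable_finsetSum _ fun l _ => hW _).const_mul _).integrableOn hpt
    _ = ∫ x in D, |tupleAvg g (Finset.range k) x| ∂μ := by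
        rw [integral_const_mul, integral_finsetSum _ fun l _ => (hW _).integrableOn,
          Finset.sum_congr rfl heq, Finset.sum_const, Finset.card_range, nsmul_eq_mul]
        push_cast
        field_simp

/-- A Hájek–Rényi inequality for U-statistics: it bounds the maximum of `k |U_k|`, and not only that
of `|U_k|`, by first moments. -/
theorem mul_measure_exists_le_sum {m : ℕ} {g : (Fin m → ℝ) → ℝ} (hg : Measurable g)
    {μ : Measure (ℕ → ℝ)} [IsProbabilityMeasure μ]
    (hμ : ∀ σ : Equiv.Perm ℕ, MeasurePreserving (fun (x : ℕ → ℝ) l => x (σ l)) μ μ)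
    (hint : ∀ i : Fin m → ℕ, Function.Injective i → Integrable (fun x => g (fun j => x (i j))) μ)
    {n : ℕ} (hn : m ≤ n) (c : ℝ) :
    c * μ.real {x | ∃ k, m ≤ k ∧ k ≤ n ∧ c ≤ k * |tupleAvg g (Finset.range k) x|} ≤
      m * ∫ x, |tupleAvg g (Finset.range m) x| ∂μ +
        ∑ k ∈ Finset.Ioc m n, ∫ x, |tupleAvg g (Finset.range k) x| ∂μ := by
  set W : ℕ → (ℕ → ℝ) → ℝ := fun k x => |tupleAvg g (Finset.range k) x| with hWdef
  have hW : ∀ k, Integrable (W k) μ := fun k => (integrable_tupleAvg hint _).abs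
  have hWm : ∀ k, Measurable (W k) := fun k => (measurable_tupleAvg hg _).abs
  have hW0 : ∀ k x, 0 ≤ W k x := fun k x => abs_nonneg _
  set D : ℕ → Set (ℕ → ℝ) := fun K => {x | ∃ k, K ≤ k ∧ k ≤ n ∧ c ≤ k * W k x} with hDdef
  have hDm : ∀ K, MeasurableSet (D K) := by
    intro K
    have : D K = ⋃ k ∈ Finset.Icc K n, {x | c ≤ k * W k x} := by
      ext x; simp [hDdef, and_assoc]
    rw [this]
    exact Finset.measurableSet_biUnion _ fun k _ =>
      measurableSet_le measurable_const ((hWm k).const_mul _)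
  have hmk : ∀ (k : ℕ) (A : Set (ℕ → ℝ)), MeasurableSet A → A ⊆ {x | c ≤ k * W k x} →
      c * μ.real A ≤ k * ∫ x in A, W k x ∂μ := by
    intro k A hA hsub
    rw [← integral_const_mul, mul_comm, ← smul_eq_mul, ← setIntegral_const]
    exact setIntegral_mono_on (integrable_const _).integrableOn
      ((hW k).const_mul _).integrableOn hA fun x hx => hsub hx
  have key : ∀ K, K ≤ n → m ≤ K → c * μ.real (D K) ≤ K * ∫ x in D K, W K x ∂μ +
      ∑ k ∈ Finset.Ioc K n, ∫ x, W k x ∂μ := by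
    intro K hK
    induction hK using Nat.decreasingInduction with
    | self =>
      intro _
      have : D n ⊆ {x | c ≤ n * W n x} := by
        rintro x ⟨k, h1, h2, h3⟩
        obtain rfl : k = n := le_antisymm h2 h1
        exact h3
      simpa using hmk n (D n) (hDm n) this
    | of_succ K hK ih =>
      intro hmK
      have ih := ih (by omega)
      -- split according to whether `K` is the last time at which the level is exceeded
      have hsplit : D K = (D K \ D (K + 1)) ∪ D (K + 1) := by
        refine (Set.sdiff_union_of_subset ?_).symm
        rintro x ⟨k, h1, h2⟩
        exact ⟨k, by omega, h2⟩
      have hA : MeasurableSet (D K \ D (K + 1)) := (hDm K).diff (hDm (K + 1))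
      have hAsub : D K \ D (K + 1) ⊆ {x | c ≤ K * W K x} := by
        rintro x ⟨⟨k, h1, h2, h3⟩, hx⟩
        rcases h1.eq_or_lt with rfl | h1
        · exact h3
        · exact absurd ⟨k, h1, h2, h3⟩ hx
      have hAk := hmk K _ hA hAsub
      have hstep : ∫ x in D (K + 1), W (K + 1) x ∂μ ≤ ∫ x in D (K + 1), W K x ∂μ := by
        refine setIntegral_abs_tupleAvg_succ_le hg hμ hint hmK (hDm _) ?_
        intro l hl x
        have : ∀ k, K + 1 ≤ k → W k (fun a => x (Equiv.swap l K a)) = W k x := by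
          intro k hk
          simp only [hWdef]
          rw [tupleAvg_range_comp_perm g (σ := Equiv.swap l K)]
          intro a ha
          exact Equiv.swap_apply_of_ne_of_ne (by omega) (by omega)
        constructor
        · rintro ⟨k, h1, h2, h3⟩
          exact ⟨k, h1, h2, by rwa [this k h1] at h3⟩
        · rintro ⟨k, h1, h2, h3⟩
          exact ⟨k, h1, h2, by rwa [this k h1]⟩
      have hle : ∫ x in D (K + 1), W (K + 1) x ∂μ ≤ ∫ x, W (K + 1) x ∂μ :=
        setIntegral_le_integral (hW _) (ae_of_all _ (hW0 _))
      have hint2 : ∫ x in D K, W K x ∂μ =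
          ∫ x in D K \ D (K + 1), W K x ∂μ + ∫ x in D (K + 1), W K x ∂μ := by
        conv_lhs => rw [hsplit]
        exact setIntegral_union Set.disjoint_sdiff_left (hDm _) (hW _).integrableOn
          (hW _).integrableOn
      have hμ2 : μ.real (D K) = μ.real (D K \ D (K + 1)) + μ.real (D (K + 1)) := by
        conv_lhs => rw [hsplit]
        exact measureReal_union Set.disjoint_sdiff_left (hDm _)
      have hsum : ∑ k ∈ Finset.Ioc K n, ∫ x, W k x ∂μ = ∫ x, W (K + 1) x ∂μ +
          ∑ k ∈ Finset.Ioc (K + 1) n, ∫ x, W k x ∂μ := by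
        rw [← Finset.sum_Ioc_consecutive _ (Nat.le_succ K) hK]
        simp
      rw [hμ2, hint2, hsum]
      push_cast at ih
      have hmul : (K : ℝ) * ∫ x in D (K + 1), W (K + 1) x ∂μ ≤
          K * ∫ x in D (K + 1), W K x ∂μ := by gcongr
      linarith
  have h1 := key m hn le_rfl
  have h2 : ∫ x in D m, W m x ∂μ ≤ ∫ x, W m x ∂μ :=
    setIntegral_le_integral (hW m) (ae_of_all _ (hW0 m))
  have h3 : (m : ℝ) * ∫ x in D m, W m x ∂μ ≤ m * ∫ x, W m x ∂μ := by gcongr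
  linarith

section

/-! ### I.i.d. sequences and tuples -/

/-- The law of an i.i.d. sequence of observations with distribution `F`. -/
noncomputable abbrev seqLaw (F : Measure ℝ) [IsProbabilityMeasure F] : Measure (ℕ → ℝ) :=
  Measure.infinitePi fun _ => F

/-- The law of `m` independent observations with distribution `F`. -/
noncomputable abbrev tupleLaw (F : Measure ℝ) (m : ℕ) : Measure (Fin m → ℝ) :=
  Measure.pi fun _ => F

variable (F : Measure ℝ) [IsProbabilityMeasure F]

lemma iIndepFun_eval_seqLaw : iIndepFun (fun (i : ℕ) (x : ℕ → ℝ) => x i) (seqLaw F) :=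
  iIndepFun_infinitePi (P := fun _ : ℕ => F) (X := fun _ => id) fun _ => measurable_id

lemma map_eval_seqLaw (i : ℕ) : (seqLaw F).map (fun x => x i) = F :=
  Measure.infinitePi_map_eval (fun _ => F) i

lemma measurePreserving_perm_seqLaw (σ : Equiv.Perm ℕ) :
    MeasurePreserving (fun (x : ℕ → ℝ) l => x (σ l)) (seqLaw F) (seqLaw F) := by
  refine ⟨by fun_prop, ?_⟩
  rw [((iIndepFun_eval_seqLaw F).precomp σ.injective).map_fun_eq_infinitePi_map
    (fun i => measurable_pi_apply _)]
  simp_rw [map_eval_seqLaw]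

lemma measurePreserving_tuple {m : ℕ} {i : Fin m → ℕ} (hi : Function.Injective i) :
    MeasurePreserving (fun (x : ℕ → ℝ) j => x (i j)) (seqLaw F) (tupleLaw F m) := by
  refine ⟨by fun_prop, ?_⟩
  rw [(iIndepFun_iff_map_fun_eq_pi_map (f := fun (j : Fin m) (x : ℕ → ℝ) => x (i j))
    (fun j => (measurable_pi_apply _).aemeasurable)).1 ((iIndepFun_eval_seqLaw F).precomp hi)]
  simp_rw [map_eval_seqLaw]

lemma measurePreserving_cons (r : ℕ) :
    MeasurePreserving (fun z : ℝ × (Fin r → ℝ) => (Fin.cons z.1 z.2 : Fin (r + 1) → ℝ))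
      (F.prod (tupleLaw F r)) (tupleLaw F (r + 1)) := by
  have h := (measurePreserving_piFinSuccAbove (fun _ : Fin (r + 1) => F) 0).symm
  convert h using 1
  funext z
  simp [MeasurableEquiv.piFinSuccAbove, Fin.insertNthEquiv]

lemma measurable_cons (r : ℕ) :
    Measurable (fun z : ℝ × (Fin r → ℝ) => (Fin.cons z.1 z.2 : Fin (r + 1) → ℝ)) :=
  (measurePreserving_cons (Measure.dirac 0) r).measurable

lemma integral_comp_tuple {m : ℕ} {f : (Fin m → ℝ) → ℝ} (hf : Measurable f) {i : Fin m → ℕ}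
    (hi : Function.Injective i) :
    ∫ x, f (fun j => x (i j)) ∂seqLaw F = ∫ y, f y ∂tupleLaw F m := by
  have h := measurePreserving_tuple F hi
  rw [← h.map_eq, integral_map h.measurable.aemeasurable hf.aestronglyMeasurable]

lemma integrable_of_bounded {α : Type*} [MeasurableSpace α] {μ : Measure α} [IsFiniteMeasure μ]
    {f : α → ℝ} (hf : Measurable f) {C : ℝ} (hC : ∀ x, |f x| ≤ C) : Integrable f μ :=
  Integrable.of_bound hf.aestronglyMeasurable C (ae_of_all _ hC)

/-! ### The second moment of a degenerate U-statistic -/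

/-- Two summands of a degenerate U-statistic are orthogonal if they share at most one
observation. -/
lemma integral_mul_eq_zero {r : ℕ} {g : (Fin (r + 1) → ℝ) → ℝ} (hg : Measurable g) {C : ℝ}
    (hC : ∀ y, |g y| ≤ C) (g_symm : ∀ (σ : Equiv.Perm (Fin (r + 1))) y, g (y ∘ σ) = g y)
    (hdeg : ∀ᵐ x ∂F, ∫ t, g (Fin.cons x t) ∂tupleLaw F r = 0)
    {i i' : Fin (r + 1) → ℕ} (hi' : Function.Injective i') {a : Fin (r + 1)}
    (ha : ∀ b, b ≠ a → ∀ d, i' b ≠ i d) :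
    ∫ x, g (fun j => x (i j)) * g (fun j => x (i' j)) ∂seqLaw F = 0 := by
  -- by symmetry the shared observation may be assumed to be the first one of `i'`
  wlog ha0 : a = 0 generalizing i' a
  · have h := this (i' := i' ∘ Equiv.swap 0 a) (a := 0) (hi'.comp (Equiv.injective _)) ?_ rfl
    · rw [← h]
      refine integral_congr_ae (ae_of_all _ fun x => ?_)
      exact congrArg _ (g_symm (Equiv.swap 0 a) (fun j => x (i' j))).symm
    · intro b hb d
      refine ha _ ?_ d
      intro h
      rw [Equiv.swap_apply_eq_iff, Equiv.swap_apply_right] at h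
      exact hb h
  subst ha0
  let S : Finset ℕ := insert (i' 0) (Finset.univ.image i)
  let T : Finset ℕ := Finset.univ.image fun b : Fin r => i' b.succ
  have hST : Disjoint S T := by
    rw [Finset.disjoint_right]
    intro l hl hl'
    obtain ⟨b, _, rfl⟩ := Finset.mem_image.1 hl
    rcases Finset.mem_insert.1 hl' with h | h
    · exact Fin.succ_ne_zero b (hi' h)
    · obtain ⟨d, _, h⟩ := Finset.mem_image.1 h
      exact ha b.succ (Fin.succ_ne_zero b) d h.symm
  have hind := (iIndepFun_eval_seqLaw F).indepFun_finset S T hST fun i => measurable_pi_apply i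
  let φ : (S → ℝ) → (Fin (r + 1) → ℝ) × ℝ := fun y =>
    (fun j => y ⟨i j, by simp [S]⟩, y ⟨i' 0, by simp [S]⟩)
  let ψ : (T → ℝ) → (Fin r → ℝ) := fun y b => y ⟨i' b.succ, by simp [T]⟩
  have hφ : Measurable φ := by fun_prop
  have hψ : Measurable ψ := by fun_prop
  have hind2 := hind.comp hφ hψ
  have hmap := (indepFun_iff_map_prod_eq_prod_map_map (hφ.comp (by fun_prop)).aemeasurable
    (hψ.comp (by fun_prop)).aemeasurable).1 hind2
  set A : (ℕ → ℝ) → (Fin (r + 1) → ℝ) × ℝ := fun x => (fun j => x (i j), x (i' 0)) with hA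
  set B : (ℕ → ℝ) → (Fin r → ℝ) := fun x b => x (i' b.succ) with hB
  have hAm : Measurable A := by fun_prop
  have hBm : Measurable B := by fun_prop
  change (seqLaw F).map (fun x => (A x, B x)) = ((seqLaw F).map A).prod ((seqLaw F).map B) at hmap
  have hBlaw : (seqLaw F).map B = tupleLaw F r :=
    (measurePreserving_tuple F (i := fun b : Fin r => i' b.succ)
      (hi'.comp (Fin.succ_injective r))).map_eq
  let G : ((Fin (r + 1) → ℝ) × ℝ) × (Fin r → ℝ) → ℝ := fun z =>
    g z.1.1 * g (Fin.cons z.1.2 z.2)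
  have hGm : Measurable G := by
    refine (hg.comp (by fun_prop)).mul (hg.comp ?_)
    exact (measurable_cons r).comp (by fun_prop : Measurable
      fun z : ((Fin (r + 1) → ℝ) × ℝ) × (Fin r → ℝ) => (z.1.2, z.2))
  have hGb : ∀ z, |G z| ≤ C * C := fun z => by
    rw [abs_mul]
    exact mul_le_mul (hC _) (hC _) (abs_nonneg _) ((abs_nonneg _).trans (hC 0))
  have : IsProbabilityMeasure ((seqLaw F).map A) :=
    Measure.isProbabilityMeasure_map hAm.aemeasurable
  have e1 : ∫ x, g (fun j => x (i j)) * g (fun j => x (i' j)) ∂seqLaw F =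
      ∫ z, G z ∂(seqLaw F).map (fun x => (A x, B x)) := by
    rw [integral_map (by fun_prop) hGm.aestronglyMeasurable]
    refine integral_congr_ae (ae_of_all _ fun x => ?_)
    have : (fun j => x (i' j)) = (Fin.cons (x (i' 0)) (B x) : Fin (r + 1) → ℝ) := by
      funext j
      refine Fin.cases ?_ (fun b => ?_) j <;> simp [hB]
    simp only [G, hA]
    rw [this]
  rw [e1, hmap, hBlaw, integral_prod _ (integrable_of_bounded hGm hGb)]
  have hdeg' : ∀ᵐ w ∂(seqLaw F).map A, ∫ t, g (Fin.cons w.2 t) ∂tupleLaw F r = 0 := by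
    have hlaw : MeasurePreserving Prod.snd ((seqLaw F).map A) F := by
      refine ⟨measurable_snd, ?_⟩
      rw [Measure.map_map measurable_snd hAm]
      exact map_eval_seqLaw F (i' 0)
    exact hlaw.quasiMeasurePreserving.ae hdeg
  rw [integral_eq_zero_of_ae]
  filter_upwards [hdeg'] with w hw
  simp only [G, integral_const_mul, hw, mul_zero, Pi.zero_apply]

lemma card_filter_pair_le (m k : ℕ) {b c : Fin m} (hbc : b ≠ c) (u v : ℕ) :
    k ^ 2 * ((Fintype.piFinset fun _ : Fin m => Finset.range k).filter
      (fun i => i b = u ∧ i c = v)).card ≤ k ^ m := by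
  let s : Fin m → Finset ℕ := fun j => if j = b then {u} else if j = c then {v} else Finset.range k
  have h1 : ((Fintype.piFinset fun _ : Fin m => Finset.range k).filter
      (fun i => i b = u ∧ i c = v)) ⊆ Fintype.piFinset s := by
    intro i hi
    simp only [Finset.mem_filter, Fintype.mem_piFinset] at hi ⊢
    intro j
    simp only [s]
    split_ifs with h h'
    · subst h; simp [hi.2.1]
    · subst h'; simp [hi.2.2]
    · exact hi.1 j
  have h2 : (Fintype.piFinset s).card * k ^ 2 = k ^ m := by
    have hp : ∀ f : Fin m → ℕ, ∏ j, f j = f b * (f c *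
        ∏ j ∈ (Finset.univ.erase b).erase c, f j) := by
      intro f
      rw [Finset.mul_prod_erase _ _ (by simp [hbc.symm]), Finset.mul_prod_erase _ _ (by simp)]
    have h3 : ∏ j ∈ (Finset.univ.erase b).erase c, (s j).card =
        ∏ j ∈ (Finset.univ.erase b).erase c, k := by
      refine Finset.prod_congr rfl fun j hj => ?_
      simp only [Finset.mem_erase] at hj
      simp [s, hj.1, hj.2.1]
    have h4 := hp fun _ => k
    rw [Fintype.card_piFinset, hp, h3]
    simp only [Finset.prod_const, Finset.card_univ, Fintype.card_fin] at h4 ⊢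
    rw [h4]
    simp [s, hbc.symm]
    ring
  calc _ ≤ k ^ 2 * (Fintype.piFinset s).card := by gcongr
    _ = k ^ m := by rw [mul_comm, h2]

lemma pow_le_mul_descFactorial {m k : ℕ} (hm : 1 ≤ m) (hk : m ≤ k) :
    k ^ m ≤ m ^ m * k.descFactorial m := by
  have h1 := Nat.pow_sub_le_descFactorial k m
  have h2 : k ≤ m * (k + 1 - m) := by
    obtain ⟨d, rfl⟩ := Nat.exists_eq_add_of_le hk
    have : m + d + 1 - m = d + 1 := by omega
    rw [this]
    nlinarith
  calc k ^ m ≤ (m * (k + 1 - m)) ^ m := Nat.pow_le_pow_left h2 m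
    _ = m ^ m * (k + 1 - m) ^ m := Nat.mul_pow _ _ _
    _ ≤ _ := Nat.mul_le_mul_left _ h1

/-- The second moment of a degenerate U-statistic is of order `k⁻²`: only the pairs of tuples with
at least two common indices contribute to it. -/
theorem integral_sq_tupleAvg_le {r : ℕ} {g : (Fin (r + 1) → ℝ) → ℝ} (hg : Measurable g) {C : ℝ}
    (hC : ∀ y, |g y| ≤ C) (g_symm : ∀ (σ : Equiv.Perm (Fin (r + 1))) y, g (y ∘ σ) = g y)
    (hdeg : ∀ᵐ x ∂F, ∫ t, g (Fin.cons x t) ∂tupleLaw F r = 0) {k : ℕ} (hk : r + 1 ≤ k) :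
    ∫ x, tupleAvg g (Finset.range k) x ^ 2 ∂seqLaw F ≤
      ((r : ℝ) + 1) ^ (4 + (r + 1)) / (k : ℝ) ^ 2 * ∫ y, g y ^ 2 ∂tupleLaw F (r + 1) := by
  set T := injTuples (r + 1) (Finset.range k) with hT
  set N : ℝ := ((k.descFactorial (r + 1) : ℕ) : ℝ) with hN
  set V := ∫ y, g y ^ 2 ∂tupleLaw F (r + 1) with hV
  have hV0 : 0 ≤ V := integral_nonneg fun y => sq_nonneg _
  have hN0 : 0 < N := by
    rw [hN]; exact_mod_cast Nat.pos_of_ne_zero (Nat.descFactorial_eq_zero_iff_lt.not.2 (by omega))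
  have hk0 : (0 : ℝ) < k := by exact_mod_cast (show 0 < k by omega)
  have hgm : ∀ i : Fin (r + 1) → ℕ, Measurable fun x : ℕ → ℝ => g (fun j => x (i j)) :=
    fun i => hg.comp (by fun_prop)
  have hint : ∀ i i' : Fin (r + 1) → ℕ, Integrable
      (fun x : ℕ → ℝ => g (fun j => x (i j)) * g (fun j => x (i' j))) (seqLaw F) := by
    intro i i'
    refine integrable_of_bounded ((hgm i).mul (hgm i')) (C := C * C) fun x => ?_
    rw [abs_mul]
    exact mul_le_mul (hC _) (hC _) (abs_nonneg _) ((abs_nonneg _).trans (hC 0))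
  have hsq : ∀ i ∈ T, ∫ x, g (fun j => x (i j)) ^ 2 ∂seqLaw F = V := by
    intro i hi
    exact integral_comp_tuple F (f := fun y => g y ^ 2) (hg.pow_const 2) (mem_injTuples.1 hi).2
  have hterm : ∀ i ∈ T, ∀ i' ∈ T,
      ∫ x, g (fun j => x (i j)) * g (fun j => x (i' j)) ∂seqLaw F ≤
        ∑ q : Fin (r + 1) × Fin (r + 1) × Fin (r + 1) × Fin (r + 1),
          if q.1 ≠ q.2.1 ∧ i' q.1 = i q.2.2.1 ∧ i' q.2.1 = i q.2.2.2 then V else 0 := by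
    intro i hi i' hi'
    by_cases hbad : ∃ q : Fin (r + 1) × Fin (r + 1) × Fin (r + 1) × Fin (r + 1),
        q.1 ≠ q.2.1 ∧ i' q.1 = i q.2.2.1 ∧ i' q.2.1 = i q.2.2.2
    · obtain ⟨q, hq⟩ := hbad
      calc ∫ x, g (fun j => x (i j)) * g (fun j => x (i' j)) ∂seqLaw F
          ≤ ∫ x, (g (fun j => x (i j)) ^ 2 + g (fun j => x (i' j)) ^ 2) / 2 ∂seqLaw F := by
            refine integral_mono (hint i i') ?_ fun x => ?_
            · simp_rw [pow_two]
              exact ((hint i i).add (hint i' i')).div_const 2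
            · simp only
              nlinarith [sq_nonneg (g (fun j => x (i j)) - g (fun j => x (i' j)))]
        _ = V := by
            have h1 := hint i i
            have h2 := hint i' i'
            simp_rw [← pow_two] at h1 h2
            rw [integral_div, integral_add h1 h2, hsq i hi, hsq i' hi']
            ring
        _ = if q.1 ≠ q.2.1 ∧ i' q.1 = i q.2.2.1 ∧ i' q.2.1 = i q.2.2.2 then V else 0 :=
            (if_pos hq).symm
        _ ≤ _ := Finset.single_le_sum
            (f := fun q : Fin (r + 1) × Fin (r + 1) × Fin (r + 1) × Fin (r + 1) =>
              if q.1 ≠ q.2.1 ∧ i' q.1 = i q.2.2.1 ∧ i' q.2.1 = i q.2.2.2 then V else 0)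
            (fun q _ => by split_ifs <;> simp [hV0]) (Finset.mem_univ q)
    · have hz : ∫ x, g (fun j => x (i j)) * g (fun j => x (i' j)) ∂seqLaw F = 0 := by
        by_cases h0 : ∃ b d, i' b = i d
        · obtain ⟨b, d, hbd⟩ := h0
          refine integral_mul_eq_zero F hg hC g_symm hdeg (mem_injTuples.1 hi').2 (a := b) ?_
          intro c hc e hce
          exact hbad ⟨(c, b, e, d), hc, hce, hbd⟩
        · push Not at h0
          exact integral_mul_eq_zero F hg hC g_symm hdeg (mem_injTuples.1 hi').2 (a := 0)
            fun b _ d => h0 b d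
      rw [hz]
      exact Finset.sum_nonneg fun q _ => by split_ifs <;> simp [hV0]
  have hcount : ∀ i ∈ T, ∑ i' ∈ T,
      ∫ x, g (fun j => x (i j)) * g (fun j => x (i' j)) ∂seqLaw F ≤
        ((r : ℝ) + 1) ^ 4 * ((k : ℝ) ^ (r + 1) / (k : ℝ) ^ 2 * V) := by
    intro i hi
    refine (Finset.sum_le_sum fun i' hi' => hterm i hi i' hi').trans ?_
    rw [Finset.sum_comm]
    have hq : ∀ q : Fin (r + 1) × Fin (r + 1) × Fin (r + 1) × Fin (r + 1),
        (∑ i' ∈ T, if q.1 ≠ q.2.1 ∧ i' q.1 = i q.2.2.1 ∧ i' q.2.1 = i q.2.2.2 then V else 0) ≤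
          (k : ℝ) ^ (r + 1) / (k : ℝ) ^ 2 * V := by
      intro q
      by_cases hne : q.1 ≠ q.2.1
      · rw [← Finset.sum_filter, Finset.sum_const, nsmul_eq_mul]
        refine mul_le_mul_of_nonneg_right ?_ hV0
        rw [le_div_iff₀ (by positivity), mul_comm]
        have h1 := card_filter_pair_le (r + 1) k hne (i q.2.2.1) (i q.2.2.2)
        have h2 : (T.filter fun i' => q.1 ≠ q.2.1 ∧ i' q.1 = i q.2.2.1 ∧
            i' q.2.1 = i q.2.2.2).card ≤
            ((Fintype.piFinset fun _ : Fin (r + 1) => Finset.range k).filter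
              (fun i' => i' q.1 = i q.2.2.1 ∧ i' q.2.1 = i q.2.2.2)).card := by
          refine Finset.card_le_card fun i' hi' => ?_
          simp only [Finset.mem_filter, hT, mem_injTuples, Fintype.mem_piFinset] at hi' ⊢
          exact ⟨hi'.1.1, hi'.2.2⟩
        have h3 := (Nat.mul_le_mul_left (k ^ 2) h2).trans h1
        exact_mod_cast h3
      · simp only [hne, false_and, if_false, Finset.sum_const_zero]
        positivity
    refine (Finset.sum_le_sum fun q _ => hq q).trans (le_of_eq ?_)
    rw [Finset.sum_const, Finset.card_univ, nsmul_eq_mul]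
    simp only [Fintype.card_prod, Fintype.card_fin]
    push_cast
    ring
  have hexp : ∫ x, tupleAvg g (Finset.range k) x ^ 2 ∂seqLaw F = N⁻¹ ^ 2 *
      ∑ i ∈ T, ∑ i' ∈ T, ∫ x, g (fun j => x (i j)) * g (fun j => x (i' j)) ∂seqLaw F := by
    simp only [tupleAvg, Finset.card_range, mul_pow, ← hN, ← hT]
    rw [integral_const_mul]
    congr 1
    simp_rw [pow_two, Finset.sum_mul_sum]
    rw [integral_finsetSum _ fun i _ => integrable_finsetSum _ fun i' _ => hint i i']
    exact Finset.sum_congr rfl fun i _ => integral_finsetSum _ fun i' _ => hint i i'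
  rw [hexp]
  have hpow : (k : ℝ) ^ (r + 1) ≤ ((r : ℝ) + 1) ^ (r + 1) * N := by
    rw [hN]
    exact_mod_cast pow_le_mul_descFactorial (Nat.succ_pos r) hk
  have hsum := Finset.sum_le_sum hcount
  rw [Finset.sum_const, hT, card_injTuples, Finset.card_range, nsmul_eq_mul, ← hN, ← hT] at hsum
  calc _ ≤ N⁻¹ ^ 2 * (N * (((r : ℝ) + 1) ^ 4 * ((k : ℝ) ^ (r + 1) / (k : ℝ) ^ 2 * V))) := by
        gcongr
    _ ≤ N⁻¹ ^ 2 * (N * (((r : ℝ) + 1) ^ 4 *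
          (((r : ℝ) + 1) ^ (r + 1) * N / (k : ℝ) ^ 2 * V))) := by gcongr
    _ = _ := by
        field_simp
        ring

end

section

variable (F : Measure ℝ)

/-! ### Removing the linear part of a kernel -/

/-- `E h(x, X_2, …, X_m)`, for observations with distribution `F`. -/
noncomputable def condMean {r : ℕ} (h : (Fin (r + 1) → ℝ) → ℝ) (x : ℝ) : ℝ :=
  ∫ t, h (Fin.cons x t) ∂tupleLaw F r

/-- The kernel `h` minus its mean and its linear (Hájek) projection. -/
noncomputable def degen {r : ℕ} (h : (Fin (r + 1) → ℝ) → ℝ) (y : Fin (r + 1) → ℝ) : ℝ :=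
  h y - ∫ z, h z ∂tupleLaw F (r + 1) -
    ∑ j, (condMean F h (y j) - ∫ z, h z ∂tupleLaw F (r + 1))

lemma degen_symm {r : ℕ} {h : (Fin (r + 1) → ℝ) → ℝ}
    (h_symm : ∀ (σ : Equiv.Perm (Fin (r + 1))) x, h (x ∘ σ) = h x)
    (σ : Equiv.Perm (Fin (r + 1))) (y : Fin (r + 1) → ℝ) : degen F h (y ∘ σ) = degen F h y := by
  unfold degen
  rw [h_symm]
  congr 1
  exact Equiv.sum_comp σ fun j => condMean F h (y j) - ∫ z, h z ∂tupleLaw F (r + 1)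

section
variable {F} [IsProbabilityMeasure F] {r : ℕ} {h : (Fin (r + 1) → ℝ) → ℝ}

lemma measurable_condMean (hm : Measurable h) : Measurable (condMean F h) := by
  have h1 : StronglyMeasurable fun z : ℝ × (Fin r → ℝ) => h (Fin.cons z.1 z.2) :=
    (hm.comp (measurable_cons r)).stronglyMeasurable
  exact h1.integral_prod_right'.measurable

lemma measurable_degen (hm : Measurable h) : Measurable (degen F h) := by
  unfold degen
  have := measurable_condMean (F := F) hm
  fun_prop

lemma integrable_cons (hi : Integrable h (tupleLaw F (r + 1))) :
    Integrable (fun z : ℝ × (Fin r → ℝ) => h (Fin.cons z.1 z.2)) (F.prod (tupleLaw F r)) :=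
  (measurePreserving_cons F r).integrable_comp_of_integrable hi

lemma integral_cons (hm : Measurable h) :
    ∫ z : ℝ × (Fin r → ℝ), h (Fin.cons z.1 z.2) ∂F.prod (tupleLaw F r) =
      ∫ y, h y ∂tupleLaw F (r + 1) := by
  rw [← (measurePreserving_cons F r).map_eq,
    integral_map (measurable_cons r).aemeasurable hm.aestronglyMeasurable]

lemma integrable_condMean (hi : Integrable h (tupleLaw F (r + 1))) :
    Integrable (condMean F h) F :=
  (integrable_cons hi).integral_prod_left

lemma integral_condMean (hm : Measurable h) (hi : Integrable h (tupleLaw F (r + 1))) :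
    ∫ x, condMean F h x ∂F = ∫ y, h y ∂tupleLaw F (r + 1) := by
  rw [← integral_cons hm, integral_prod _ (integrable_cons hi)]
  rfl

lemma integral_abs_condMean_le (hm : Measurable h) (hi : Integrable h (tupleLaw F (r + 1))) :
    ∫ x, |condMean F h x| ∂F ≤ ∫ y, |h y| ∂tupleLaw F (r + 1) := by
  rw [← integral_condMean hm.abs hi.abs]
  refine integral_mono (integrable_condMean hi).abs (integrable_condMean hi.abs) fun x => ?_
  exact abs_integral_le_integral_abs

lemma sq_integral_le {α : Type*} [MeasurableSpace α] {μ : Measure α} [IsProbabilityMeasure μ]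
    {f : α → ℝ} (hf : Measurable f) {C : ℝ} (hC : ∀ x, |f x| ≤ C) :
    (∫ x, f x ∂μ) ^ 2 ≤ ∫ x, f x ^ 2 ∂μ := by
  have h1 : MemLp f 2 μ := MemLp.of_bound hf.aestronglyMeasurable C (ae_of_all _ hC)
  have h2 := variance_nonneg f μ
  rw [variance_eq_sub h1] at h2
  simpa using h2

lemma abs_condMean_le {C : ℝ} (hC : ∀ y, |h y| ≤ C) (x : ℝ) : |condMean F h x| ≤ C := by
  have := norm_integral_le_of_norm_le_const (μ := tupleLaw F r)
    (f := fun t => h (Fin.cons x t)) (ae_of_all _ fun t => hC _)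
  simpa [condMean] using this

lemma integral_sq_condMean_le (hm : Measurable h) {C : ℝ} (hC : ∀ y, |h y| ≤ C) :
    ∫ x, condMean F h x ^ 2 ∂F ≤ ∫ y, h y ^ 2 ∂tupleLaw F (r + 1) := by
  have hC2 : ∀ y, |h y ^ 2| ≤ C ^ 2 := fun y => by
    rw [abs_pow]; exact pow_le_pow_left₀ (abs_nonneg _) (hC y) 2
  have hi2 : Integrable (fun y => h y ^ 2) (tupleLaw F (r + 1)) :=
    integrable_of_bounded (hm.pow_const 2) hC2
  rw [← integral_condMean (h := fun y => h y ^ 2) (hm.pow_const 2) hi2]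
  refine integral_mono ?_ (integrable_condMean hi2) fun x => ?_
  · refine integrable_of_bounded ((measurable_condMean hm).pow_const 2) (C := C ^ 2) fun x => ?_
    rw [abs_pow]; exact pow_le_pow_left₀ (abs_nonneg _) (abs_condMean_le hC x) 2
  · exact sq_integral_le (hm.comp ((measurable_cons r).comp measurable_prodMk_left))
      fun t => hC _

lemma measurePreserving_eval_tupleLaw {m : ℕ} (j : Fin m) :
    MeasurePreserving (fun y : Fin m → ℝ => y j) (tupleLaw F m) F :=
  measurePreserving_eval (fun _ : Fin m => F) j

lemma integral_eval_tupleLaw {m : ℕ} (j : Fin m) {f : ℝ → ℝ} (hf : Measurable f) :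
    ∫ y, f (y j) ∂tupleLaw F m = ∫ x, f x ∂F := by
  have h := measurePreserving_eval_tupleLaw (F := F) j
  conv_rhs => rw [← h.map_eq, integral_map h.measurable.aemeasurable hf.aestronglyMeasurable]

lemma integrable_eval_tupleLaw {m : ℕ} (j : Fin m) {f : ℝ → ℝ} (hf : Integrable f F) :
    Integrable (fun y => f (y j)) (tupleLaw F m) :=
  (measurePreserving_eval_tupleLaw j).integrable_comp_of_integrable hf

lemma integrable_degen (hi : Integrable h (tupleLaw F (r + 1))) :
    Integrable (degen F h) (tupleLaw F (r + 1)) := by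
  unfold degen
  exact (hi.sub (integrable_const _)).sub (integrable_finsetSum _ fun j _ =>
    (integrable_eval_tupleLaw j (integrable_condMean hi)).sub (integrable_const _))

lemma abs_degen_le {C : ℝ} (hC : ∀ y, |h y| ≤ C) (y : Fin (r + 1) → ℝ) :
    |degen F h y| ≤ C + C + (r + 1) * (C + C) := by
  have hθ : |∫ z, h z ∂tupleLaw F (r + 1)| ≤ C := by
    have := norm_integral_le_of_norm_le_const (μ := tupleLaw F (r + 1)) (f := h) (ae_of_all _ hC)
    simpa using this
  unfold degen
  refine (abs_sub _ _).trans (add_le_add ((abs_sub _ _).trans (add_le_add (hC y) hθ)) ?_)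
  refine (Finset.abs_sum_le_sum_abs _ _).trans ?_
  refine (Finset.sum_le_sum fun j _ => (abs_sub _ _).trans
    (add_le_add (abs_condMean_le hC (y j)) hθ)).trans (le_of_eq ?_)
  simp [mul_add]

/-- `degen F h` is degenerate: its conditional mean given one observation is zero. -/
lemma condMean_degen (hm : Measurable h) (hi : Integrable h (tupleLaw F (r + 1))) :
    ∀ᵐ x ∂F, ∫ t, degen F h (Fin.cons x t) ∂tupleLaw F r = 0 := by
  filter_upwards [(integrable_cons hi).prod_right_ae] with x hx
  have hq : Integrable (fun x => condMean F h x - ∫ z, h z ∂tupleLaw F (r + 1)) F :=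
    (integrable_condMean hi).sub (integrable_const _)
  have hq0 : ∀ j : Fin r, ∫ t : Fin r → ℝ,
      (condMean F h (t j) - ∫ z, h z ∂tupleLaw F (r + 1)) ∂tupleLaw F r = 0 := by
    intro j
    rw [integral_eval_tupleLaw j (f := fun x => condMean F h x - ∫ z, h z ∂tupleLaw F (r + 1))
      ((measurable_condMean hm).sub_const _), integral_sub (integrable_condMean hi)
      (integrable_const _), integral_condMean hm hi]
    simp
  have hqi : Integrable (fun t : Fin r → ℝ => ∑ j,
      (condMean F h (t j) - ∫ z, h z ∂tupleLaw F (r + 1))) (tupleLaw F r) :=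
    integrable_finsetSum _ fun j _ => integrable_eval_tupleLaw j hq
  have hx2 : Integrable (fun t : Fin r → ℝ => h (Fin.cons x t)) (tupleLaw F r) := hx
  simp only [degen, Fin.sum_univ_succ, Fin.cons_zero, Fin.cons_succ]
  have i1 : Integrable (fun t : Fin r → ℝ => h (Fin.cons x t) - ∫ z, h z ∂tupleLaw F (r + 1))
      (tupleLaw F r) := hx2.sub (integrable_const _)
  have i2 : Integrable (fun t : Fin r → ℝ => condMean F h x - ∫ z, h z ∂tupleLaw F (r + 1) +
      ∑ j, (condMean F h (t j) - ∫ z, h z ∂tupleLaw F (r + 1))) (tupleLaw F r) :=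
    (integrable_const _).add hqi
  rw [integral_sub i1 i2,
    integral_sub hx2 (integrable_const _), integral_add (integrable_const _) hqi,
    integral_finsetSum _ fun j _ => integrable_eval_tupleLaw j hq]
  simp only [hq0, Finset.sum_const_zero, integral_const, probReal_univ, one_smul]
  simp [condMean]

lemma integral_abs_degen_le (hm : Measurable h) (hi : Integrable h (tupleLaw F (r + 1))) :
    ∫ y, |degen F h y| ∂tupleLaw F (r + 1) ≤
      (2 + 2 * ((r : ℝ) + 1)) * ∫ y, |h y| ∂tupleLaw F (r + 1) := by
  set θ := ∫ z, h z ∂tupleLaw F (r + 1) with hθ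
  set M := ∫ y, |h y| ∂tupleLaw F (r + 1) with hM
  have hθM : |θ| ≤ M := abs_integral_le_integral_abs
  have hci : ∀ j : Fin (r + 1), Integrable (fun y : Fin (r + 1) → ℝ => |condMean F h (y j)| + |θ|)
      (tupleLaw F (r + 1)) := fun j =>
    (integrable_eval_tupleLaw j (integrable_condMean hi).abs).add (integrable_const _)
  have i1 : Integrable (fun y => |h y| + |θ|) (tupleLaw F (r + 1)) :=
    hi.abs.add (integrable_const _)
  calc ∫ y, |degen F h y| ∂tupleLaw F (r + 1)
      ≤ ∫ y, (|h y| + |θ| + ∑ j, (|condMean F h (y j)| + |θ|)) ∂tupleLaw F (r + 1) := by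
        refine integral_mono (integrable_degen hi).abs
          (i1.add (integrable_finsetSum _ fun j _ => hci j))
          fun y => ?_
        refine (abs_sub _ _).trans (add_le_add (abs_sub _ _) ?_)
        exact (Finset.abs_sum_le_sum_abs _ _).trans (Finset.sum_le_sum fun j _ => abs_sub _ _)
    _ = M + |θ| + ∑ j : Fin (r + 1), (∫ x, |condMean F h x| ∂F + |θ|) := by
        rw [integral_add i1 (integrable_finsetSum _ fun j _ => hci j),
          integral_add hi.abs (integrable_const _), integral_finsetSum _ fun j _ => hci j]
        congr 1
        · simp [hM]
        · refine Finset.sum_congr rfl fun j _ => ?_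
          rw [integral_add (integrable_eval_tupleLaw j (integrable_condMean hi).abs)
            (integrable_const _), integral_eval_tupleLaw j (f := fun x => |condMean F h x|)
            (measurable_condMean hm).abs]
          simp
    _ ≤ M + M + ∑ j : Fin (r + 1), (M + M) := by
        gcongr
        exact integral_abs_condMean_le hm hi
    _ = _ := by
        simp
        ring

lemma integral_sq_degen_le (hm : Measurable h) {C : ℝ} (hC : ∀ y, |h y| ≤ C) :
    ∫ y, degen F h y ^ 2 ∂tupleLaw F (r + 1) ≤
      (3 + 6 * ((r : ℝ) + 1) ^ 2) * ∫ y, h y ^ 2 ∂tupleLaw F (r + 1) := by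
  set θ := ∫ z, h z ∂tupleLaw F (r + 1) with hθ
  set M := ∫ y, h y ^ 2 ∂tupleLaw F (r + 1) with hM
  have hθM : θ ^ 2 ≤ M := sq_integral_le hm hC
  have hsqb : ∀ {a D : ℝ}, |a| ≤ D → |a ^ 2| ≤ D ^ 2 := fun h => by
    rw [abs_pow]; exact pow_le_pow_left₀ (abs_nonneg _) h 2
  have hcm := measurable_condMean (F := F) hm
  have hci : ∀ j : Fin (r + 1), Integrable (fun y : Fin (r + 1) → ℝ => condMean F h (y j) ^ 2)
      (tupleLaw F (r + 1)) := fun j =>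
    integrable_of_bounded (by fun_prop) fun y => hsqb (abs_condMean_le hC (y j))
  have hi2 : Integrable (fun y => h y ^ 2) (tupleLaw F (r + 1)) :=
    integrable_of_bounded (hm.pow_const 2) fun y => hsqb (hC y)
  have i1 : Integrable (fun y => h y ^ 2 + ((r : ℝ) + 1) ^ 2 * θ ^ 2) (tupleLaw F (r + 1)) :=
    hi2.add (integrable_const _)
  have i2 : Integrable (fun y : Fin (r + 1) → ℝ => ((r : ℝ) + 1) * ∑ j, condMean F h (y j) ^ 2)
      (tupleLaw F (r + 1)) := (integrable_finsetSum _ fun j _ => hci j).const_mul _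
  have hpt : ∀ y, degen F h y ^ 2 ≤ 3 * (h y ^ 2 + ((r : ℝ) + 1) ^ 2 * θ ^ 2 +
      ((r : ℝ) + 1) * ∑ j, condMean F h (y j) ^ 2) := by
    intro y
    have h1 : degen F h y = h y + r * θ - ∑ j, condMean F h (y j) := by
      unfold degen
      rw [Finset.sum_sub_distrib]
      simp
      ring
    have h2 := sq_sum_le_card_mul_sum_sq (s := (Finset.univ : Finset (Fin (r + 1))))
      (f := fun j => condMean F h (y j))
    simp only [Finset.card_univ, Fintype.card_fin] at h2
    push_cast at h2
    have h3 : (r * θ) ^ 2 ≤ ((r : ℝ) + 1) ^ 2 * θ ^ 2 := by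
      rw [mul_pow]; gcongr; linarith
    rw [h1]
    set s := ∑ j, condMean F h (y j)
    nlinarith [sq_nonneg (h y - r * θ), sq_nonneg (h y + s), sq_nonneg (r * θ + s)]
  calc ∫ y, degen F h y ^ 2 ∂tupleLaw F (r + 1)
      ≤ ∫ y, 3 * (h y ^ 2 + ((r : ℝ) + 1) ^ 2 * θ ^ 2 +
          ((r : ℝ) + 1) * ∑ j, condMean F h (y j) ^ 2) ∂tupleLaw F (r + 1) :=
        integral_mono (integrable_of_bounded ((measurable_degen hm).pow_const 2)
          fun y => hsqb (abs_degen_le hC y)) ((i1.add i2).const_mul 3) hpt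
    _ = 3 * (M + ((r : ℝ) + 1) ^ 2 * θ ^ 2 +
          ((r : ℝ) + 1) * ∑ j : Fin (r + 1), ∫ x, condMean F h x ^ 2 ∂F) := by
        rw [integral_const_mul, integral_add i1 i2,
          integral_add hi2 (integrable_const _),
          integral_const_mul _ (fun y : Fin (r + 1) → ℝ => ∑ j, condMean F h (y j) ^ 2),
          integral_finsetSum _ fun j _ => hci j]
        simp_rw [fun j => integral_eval_tupleLaw (F := F) (m := r + 1) j (hcm.pow_const 2)]
        simp [hM]
    _ ≤ 3 * (M + ((r : ℝ) + 1) ^ 2 * M + ((r : ℝ) + 1) * ∑ j : Fin (r + 1), M) := by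
        gcongr
        exact integral_sq_condMean_le hm hC
    _ = _ := by
        simp
        ring

lemma degen_add {h' : (Fin (r + 1) → ℝ) → ℝ} (hi : Integrable h (tupleLaw F (r + 1)))
    (hi' : Integrable h' (tupleLaw F (r + 1))) :
    ∀ᵐ y ∂tupleLaw F (r + 1),
      degen F (fun y => h y + h' y) y = degen F h y + degen F h' y := by
  have hx : ∀ᵐ x ∂F, condMean F (fun y => h y + h' y) x = condMean F h x + condMean F h' x := by
    filter_upwards [(integrable_cons hi).prod_right_ae, (integrable_cons hi').prod_right_ae]
      with x h1 h2
    exact integral_add h1 h2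
  have hy : ∀ᵐ y ∂tupleLaw F (r + 1), ∀ j,
      condMean F (fun y => h y + h' y) (y j) = condMean F h (y j) + condMean F h' (y j) :=
    ae_all_iff.2 fun j => (measurePreserving_eval_tupleLaw j).quasiMeasurePreserving.ae hx
  filter_upwards [hy] with y hy
  simp only [degen, hy, integral_add hi hi', Finset.sum_sub_distrib, Finset.sum_add_distrib]
  simp
  ring

end

end

/-! ### The first moment of the degenerate part under a moment of order `4 / 3` -/

lemma abs_tupleAvg_le {m : ℕ} (g : (Fin m → ℝ) → ℝ) (S : Finset ℕ) (x : ℕ → ℝ) :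
    |tupleAvg g S x| ≤ tupleAvg (fun y => |g y|) S x := by
  unfold tupleAvg
  rw [abs_mul, abs_of_nonneg (by positivity : (0 : ℝ) ≤ ((S.card.descFactorial m : ℕ) : ℝ)⁻¹)]
  gcongr
  exact Finset.abs_sum_le_sum_abs _ _

lemma tupleAvg_le_of_le {m : ℕ} {g : (Fin m → ℝ) → ℝ} {C : ℝ} (hC0 : 0 ≤ C) (hC : ∀ y, g y ≤ C)
    (S : Finset ℕ) (x : ℕ → ℝ) : tupleAvg g S x ≤ C := by
  unfold tupleAvg
  have h1 : ∑ i ∈ injTuples m S, g (fun j => x (i j)) ≤ (S.card.descFactorial m : ℕ) * C := by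
    rw [← card_injTuples, ← nsmul_eq_mul, ← Finset.sum_const]
    exact Finset.sum_le_sum fun i _ => hC _
  rw [inv_mul_eq_div]
  exact div_le_of_le_mul₀ (by positivity) hC0 (by linarith)

section
variable {F : Measure ℝ} [IsProbabilityMeasure F]

lemma integrable_tuple {m : ℕ} {g : (Fin m → ℝ) → ℝ} (hi : Integrable g (tupleLaw F m))
    (i : Fin m → ℕ) (hinj : Function.Injective i) :
    Integrable (fun x => g (fun j => x (i j))) (seqLaw F) :=
  (measurePreserving_tuple F hinj).integrable_comp_of_integrable hi

lemma integral_abs_tupleAvg_le {m : ℕ} {g : (Fin m → ℝ) → ℝ} (hg : Measurable g)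
    (hi : Integrable g (tupleLaw F m)) (S : Finset ℕ) :
    ∫ x, |tupleAvg g S x| ∂seqLaw F ≤ ∫ y, |g y| ∂tupleLaw F m := by
  calc ∫ x, |tupleAvg g S x| ∂seqLaw F ≤ ∫ x, tupleAvg (fun y => |g y|) S x ∂seqLaw F :=
        integral_mono (integrable_tupleAvg (integrable_tuple hi) S).abs
          (integrable_tupleAvg (integrable_tuple hi.abs) S) fun x => abs_tupleAvg_le g S x
    _ = ((S.card.descFactorial m : ℕ) : ℝ)⁻¹ *
        ((S.card.descFactorial m : ℕ) * ∫ y, |g y| ∂tupleLaw F m) := by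
        unfold tupleAvg
        rw [integral_const_mul, integral_finsetSum _ fun i hii =>
          integrable_tuple hi.abs i (mem_injTuples.1 hii).2,
          Finset.sum_congr rfl fun i hii =>
            integral_comp_tuple F (f := fun y => |g y|) hg.abs (mem_injTuples.1 hii).2,
          Finset.sum_const, card_injTuples, nsmul_eq_mul]
    _ ≤ ∫ y, |g y| ∂tupleLaw F m := by
        rw [← mul_assoc]
        refine mul_le_of_le_one_left (integral_nonneg fun y => abs_nonneg _) ?_
        exact inv_mul_le_one

lemma tupleAvg_congr_ae {m : ℕ} {g g' : (Fin m → ℝ) → ℝ} (h : g =ᵐ[tupleLaw F m] g')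
    (S : Finset ℕ) : tupleAvg g S =ᵐ[seqLaw F] tupleAvg g' S := by
  have h1 : ∀ᵐ x ∂seqLaw F, ∀ i ∈ injTuples m S, g (fun j => x (i j)) = g' (fun j => x (i j)) := by
    refine (Finset.eventually_all _).2 fun i hi => ?_
    exact (measurePreserving_tuple F (mem_injTuples.1 hi).2).quasiMeasurePreserving.ae h
  filter_upwards [h1] with x hx
  unfold tupleAvg
  rw [Finset.sum_congr rfl hx]

lemma sqrt_mul_integral_abs_le {r : ℕ} {h a b : (Fin (r + 1) → ℝ) → ℝ}
    (hab : h = fun y => a y + b y) (h_symm : ∀ (σ : Equiv.Perm (Fin (r + 1))) x, a (x ∘ σ) = a x)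
    (ham : Measurable a) {C : ℝ} (haC : ∀ y, |a y| ≤ C) (hbm : Measurable b)
    (hbi : Integrable b (tupleLaw F (r + 1))) {k : ℕ} (hk : r + 1 ≤ k) :
    √k * ∫ x, |tupleAvg (degen F h) (Finset.range k) x| ∂seqLaw F ≤
      √(((r : ℝ) + 1) ^ (4 + (r + 1)) * (3 + 6 * ((r : ℝ) + 1) ^ 2) *
        ∫ y, a y ^ 2 / k ∂tupleLaw F (r + 1)) +
      (2 + 2 * ((r : ℝ) + 1)) * ∫ y, √k * |b y| ∂tupleLaw F (r + 1) := by
  have hk0 : (0 : ℝ) < k := by exact_mod_cast (show 0 < k by omega)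
  have hai : Integrable a (tupleLaw F (r + 1)) := integrable_of_bounded ham haC
  set S := Finset.range k
  have hdec : tupleAvg (degen F h) S =ᵐ[seqLaw F]
      fun x => tupleAvg (degen F a) S x + tupleAvg (degen F b) S x := by
    have h1 : degen F h =ᵐ[tupleLaw F (r + 1)] fun y => degen F a y + degen F b y := by
      rw [hab]; exact degen_add hai hbi
    filter_upwards [tupleAvg_congr_ae h1 S] with x hx
    rw [hx, tupleAvg_add]
  have hDa := integrable_tupleAvg (integrable_tuple (integrable_degen hai)) S
  have hDb := integrable_tupleAvg (integrable_tuple (integrable_degen hbi)) S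
  have hC0 : 0 ≤ C := (abs_nonneg _).trans (haC 0)
  have hbd : ∀ x, |(|tupleAvg (degen F a) S x|)| ≤ C + C + (r + 1) * (C + C) := fun x => by
    rw [abs_abs]
    exact (abs_tupleAvg_le _ S x).trans
      (tupleAvg_le_of_le (by positivity) (fun y => abs_degen_le haC y) S x)
  have h1 : ∫ x, |tupleAvg (degen F h) S x| ∂seqLaw F ≤
      ∫ x, |tupleAvg (degen F a) S x| ∂seqLaw F + ∫ x, |tupleAvg (degen F b) S x| ∂seqLaw F := by
    rw [← integral_add hDa.abs hDb.abs]
    refine integral_mono_ae ?_ (hDa.abs.add hDb.abs) ?_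
    · exact ((hDa.add hDb).congr hdec.symm).abs
    · filter_upwards [hdec] with x hx
      rw [hx]
      exact abs_add_le _ _
  have h2 : (∫ x, |tupleAvg (degen F a) S x| ∂seqLaw F) ^ 2 ≤
      ((r : ℝ) + 1) ^ (4 + (r + 1)) / (k : ℝ) ^ 2 *
        ((3 + 6 * ((r : ℝ) + 1) ^ 2) * ∫ y, a y ^ 2 ∂tupleLaw F (r + 1)) := by
    refine (sq_integral_le (measurable_tupleAvg (measurable_degen ham) S).abs hbd).trans ?_
    simp_rw [sq_abs]
    refine (integral_sq_tupleAvg_le F (measurable_degen ham) (fun y => abs_degen_le haC y)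
      (degen_symm F h_symm) (condMean_degen ham hai) hk).trans ?_
    gcongr
    exact integral_sq_degen_le ham haC
  have h3 : √k * ∫ x, |tupleAvg (degen F a) S x| ∂seqLaw F ≤
      √(((r : ℝ) + 1) ^ (4 + (r + 1)) * (3 + 6 * ((r : ℝ) + 1) ^ 2) *
        ∫ y, a y ^ 2 / k ∂tupleLaw F (r + 1)) := by
    refine Real.le_sqrt_of_sq_le ?_
    rw [mul_pow, Real.sq_sqrt hk0.le, integral_div]
    calc _ ≤ (k : ℝ) * (((r : ℝ) + 1) ^ (4 + (r + 1)) / (k : ℝ) ^ 2 *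
          ((3 + 6 * ((r : ℝ) + 1) ^ 2) * ∫ y, a y ^ 2 ∂tupleLaw F (r + 1))) := by gcongr
      _ = _ := by field_simp
  have h4 : √k * ∫ x, |tupleAvg (degen F b) S x| ∂seqLaw F ≤
      (2 + 2 * ((r : ℝ) + 1)) * ∫ y, √k * |b y| ∂tupleLaw F (r + 1) := by
    rw [integral_const_mul]
    calc _ ≤ √k * ((2 + 2 * ((r : ℝ) + 1)) * ∫ y, |b y| ∂tupleLaw F (r + 1)) := by
          gcongr
          exact (integral_abs_tupleAvg_le (measurable_degen hbm) (integrable_degen hbi) S).trans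
            (integral_abs_degen_le hbm hbi)
      _ = _ := by ring
  calc _ ≤ √k * (∫ x, |tupleAvg (degen F a) S x| ∂seqLaw F +
        ∫ x, |tupleAvg (degen F b) S x| ∂seqLaw F) := by gcongr
    _ ≤ _ := by rw [mul_add]; exact add_le_add h3 h4

/-- If `|h|` has a finite moment of order `4 / 3`, then the first absolute moment of the degenerate
part of the U-statistic is `o(k ^ (-1 / 2))`. The kernel is truncated at the level
`|h| = k ^ (3 / 2)`; the part below it is handled by second moments, the part above it by first
moments. -/
theorem tendsto_sqrt_mul_integral_abs_tupleAvg {r : ℕ} {h : (Fin (r + 1) → ℝ) → ℝ}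
    (h_symm : ∀ (σ : Equiv.Perm (Fin (r + 1))) x, h (x ∘ σ) = h x) (hm : Measurable h)
    (hi : Integrable h (tupleLaw F (r + 1)))
    (hi43 : Integrable (fun y => |h y| ^ (4 / 3 : ℝ)) (tupleLaw F (r + 1))) :
    Tendsto (fun k : ℕ => √k * ∫ x, |tupleAvg (degen F h) (Finset.range k) x| ∂seqLaw F)
      atTop (𝓝 0) := by
  set v : (Fin (r + 1) → ℝ) → ℝ := fun y => |h y| ^ (1 / 3 : ℝ) with hv
  have hv0 : ∀ y, 0 ≤ v y := fun y => by positivity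
  have hvm : Measurable v := hm.abs.pow_const _
  have hv3 : ∀ y, |h y| = v y ^ 3 := fun y => by
    simp only [hv]
    rw [← Real.rpow_natCast, ← Real.rpow_mul (abs_nonneg _)]
    norm_num
  have hv4 : Integrable (fun y => v y ^ 4) (tupleLaw F (r + 1)) := by
    refine hi43.congr (ae_of_all _ fun y => ?_)
    simp only [hv]
    rw [← Real.rpow_natCast, ← Real.rpow_mul (abs_nonneg _)]
    norm_num
  have hvs : ∀ (σ : Equiv.Perm (Fin (r + 1))) x, v (x ∘ σ) = v x := fun σ x => by
    simp only [hv, h_symm]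
  -- in terms of `v = |h| ^ (1 / 3)`, the truncation level `|h| = k ^ (3 / 2)` is `v ^ 2 = k`
  set a : ℕ → (Fin (r + 1) → ℝ) → ℝ := fun k y => if v y ^ 2 ≤ k then h y else 0 with ha
  set b : ℕ → (Fin (r + 1) → ℝ) → ℝ := fun k y => if v y ^ 2 ≤ k then 0 else h y with hb
  have hset : ∀ k : ℕ, MeasurableSet {y | v y ^ 2 ≤ (k : ℝ)} := fun k =>
    measurableSet_le (hvm.pow_const 2) measurable_const
  have ham : ∀ k, Measurable (a k) := fun k => hm.ite (hset k) measurable_const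
  have hbm : ∀ k, Measurable (b k) := fun k => measurable_const.ite (hset k) hm
  have hbi : ∀ k, Integrable (b k) (tupleLaw F (r + 1)) := fun k => by
    refine hi.mono (hbm k).aestronglyMeasurable (ae_of_all _ fun y => ?_)
    simp only [hb]
    split_ifs <;> simp
  have haC : ∀ k y, |a k y| ≤ 1 + (k : ℝ) ^ 2 := fun k y => by
    simp only [ha]
    split_ifs with hle
    · rw [hv3]
      have h1 : v y ^ 4 ≤ (k : ℝ) ^ 2 := by
        calc v y ^ 4 = (v y ^ 2) ^ 2 := by ring
          _ ≤ _ := by gcongr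
      nlinarith [sq_nonneg (v y ^ 2 - v y), sq_nonneg (v y - 1), sq_nonneg (v y), hv0 y,
        sq_nonneg (v y ^ 2 - 1)]
    · simp only [abs_zero]; positivity
  have hA : Tendsto (fun k : ℕ => ∫ y, a k y ^ 2 / k ∂tupleLaw F (r + 1)) atTop (𝓝 0) := by
    rw [← integral_zero (Fin (r + 1) → ℝ) ℝ (μ := tupleLaw F (r + 1))]
    refine tendsto_integral_of_dominated_convergence (fun y => v y ^ 4)
      (fun k => (((ham k).pow_const 2).div_const _).aestronglyMeasurable) hv4
      (fun k => ae_of_all _ fun y => ?_) (ae_of_all _ fun y => ?_)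
    · rw [Real.norm_of_nonneg (by positivity)]
      simp only [ha]
      split_ifs with hle
      · rw [← sq_abs, hv3]
        refine div_le_of_le_mul₀ (by positivity) (by positivity) ?_
        calc (v y ^ 3) ^ 2 = v y ^ 4 * v y ^ 2 := by ring
          _ ≤ _ := by gcongr
      · simp only [ne_eq, OfNat.ofNat_ne_zero, not_false_eq_true, zero_pow, zero_div]
        positivity
    · refine squeeze_zero (fun k => by positivity) (fun k => ?_)
        (tendsto_const_div_atTop_nhds_zero_nat (h y ^ 2))
      simp only [ha]
      split_ifs
      · exact le_rfl
      · simp only [ne_eq, OfNat.ofNat_ne_zero, not_false_eq_true, zero_pow, zero_div]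
        positivity
  have hB : Tendsto (fun k : ℕ => ∫ y, √k * |b k y| ∂tupleLaw F (r + 1)) atTop (𝓝 0) := by
    rw [← integral_zero (Fin (r + 1) → ℝ) ℝ (μ := tupleLaw F (r + 1))]
    refine tendsto_integral_of_dominated_convergence (fun y => v y ^ 4)
      (fun k => ((hbm k).abs.const_mul _).aestronglyMeasurable) hv4
      (fun k => ae_of_all _ fun y => ?_) (ae_of_all _ fun y => ?_)
    · rw [Real.norm_of_nonneg (by positivity)]
      simp only [hb]
      split_ifs with hle
      · simp only [abs_zero, mul_zero]; positivity
      · rw [hv3]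
        have h1 : √k ≤ v y := by
          rw [Real.sqrt_le_left (hv0 y)]
          linarith
        calc √k * v y ^ 3 ≤ v y * v y ^ 3 := by gcongr
          _ = v y ^ 4 := by ring
    · refine tendsto_const_nhds.congr' ?_
      filter_upwards [eventually_ge_atTop ⌈v y ^ 2⌉₊] with k hk
      have : v y ^ 2 ≤ k := Nat.ceil_le.1 hk
      simp [hb, this]
  have hlim : Tendsto (fun k : ℕ => √(((r : ℝ) + 1) ^ (4 + (r + 1)) *
        (3 + 6 * ((r : ℝ) + 1) ^ 2) * ∫ y, a k y ^ 2 / k ∂tupleLaw F (r + 1)) +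
      (2 + 2 * ((r : ℝ) + 1)) * ∫ y, √k * |b k y| ∂tupleLaw F (r + 1)) atTop (𝓝 0) := by
    have h1 := (Real.continuous_sqrt.tendsto _).comp (hA.const_mul
      (((r : ℝ) + 1) ^ (4 + (r + 1)) * (3 + 6 * ((r : ℝ) + 1) ^ 2)))
    have h2 := h1.add (hB.const_mul (2 + 2 * ((r : ℝ) + 1)))
    simpa using h2
  refine squeeze_zero' (Eventually.of_forall fun k =>
    mul_nonneg (Real.sqrt_nonneg _) (integral_nonneg fun x => abs_nonneg _)) ?_ hlim
  filter_upwards [eventually_ge_atTop (r + 1)] with k hk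
  refine sqrt_mul_integral_abs_le ?_ ?_ (ham k) (haC k) (hbm k) (hbi k) hk
  · funext y
    simp only [ha, hb]
    split_ifs <;> simp
  · intro σ x
    simp only [ha, hvs, h_symm]

end

section

/-! ### The norming constants are at least of order `√n` -/

lemma half_le_norm_charFun {μ : Measure ℝ} [IsProbabilityMeasure μ] {A R s : ℝ}
    (hμ : μ.real {x | R < |x - A|} ≤ 1 / 8) (hs : |s| * R ≤ 1 / 4) : 1 / 2 ≤ ‖charFun μ s‖ := by
  set E : Set ℝ := {x | R < |x - A|} with hE
  have hEm : MeasurableSet E := measurableSet_lt measurable_const (by fun_prop)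
  have hexp : ∀ x : ℝ, ‖Complex.exp (((s * (x - A) : ℝ) : ℂ) * Complex.I)‖ = 1 := fun x =>
    Complex.norm_exp_ofReal_mul_I _
  have hint : Integrable (fun x : ℝ => Complex.exp (((s * (x - A) : ℝ) : ℂ) * Complex.I)) μ :=
    Integrable.of_bound (by fun_prop) 1 (ae_of_all _ fun x => (hexp x).le)
  have hnorm : ‖charFun μ s‖ = ‖∫ x, Complex.exp (((s * (x - A) : ℝ) : ℂ) * Complex.I) ∂μ‖ := by
    have h1 : ∀ x : ℝ, Complex.exp (((s * (x - A) : ℝ) : ℂ) * Complex.I) =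
        Complex.exp (((-(s * A) : ℝ) : ℂ) * Complex.I) * Complex.exp (s * x * Complex.I) := by
      intro x
      rw [← Complex.exp_add]
      congr 1
      push_cast
      ring
    simp_rw [h1]
    rw [integral_const_mul, norm_mul, Complex.norm_exp_ofReal_mul_I, one_mul, charFun_apply_real]
  have hre : (∫ x, Complex.exp (((s * (x - A) : ℝ) : ℂ) * Complex.I) ∂μ).re =
      ∫ x, Real.cos (s * (x - A)) ∂μ := by
    have h1 := integral_re hint
    simp only [RCLike.re_to_complex, Complex.exp_ofReal_mul_I_re] at h1
    exact h1.symm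
  have hlow : ∀ x, 31 / 32 - 63 / 32 * E.indicator (fun _ => (1 : ℝ)) x ≤
      Real.cos (s * (x - A)) := by
    intro x
    by_cases hx : x ∈ E
    · rw [Set.indicator_of_mem hx]
      linarith [Real.neg_one_le_cos (s * (x - A))]
    · rw [Set.indicator_of_notMem hx]
      have h1 : |x - A| ≤ R := not_lt.1 hx
      have h2 : |s * (x - A)| ≤ 1 / 4 := by
        rw [abs_mul]
        exact (mul_le_mul_of_nonneg_left h1 (abs_nonneg s)).trans hs
      have h3 : (s * (x - A)) ^ 2 ≤ 1 / 16 := by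
        rw [← sq_abs]
        nlinarith [abs_nonneg (s * (x - A))]
      linarith [Real.one_sub_sq_div_two_le_cos (x := s * (x - A))]
  have hind : Integrable (E.indicator fun _ => (1 : ℝ)) μ :=
    (integrable_const _).indicator hEm
  have hcos : Integrable (fun x => Real.cos (s * (x - A))) μ :=
    integrable_of_bounded (by fun_prop) fun x => Real.abs_cos_le_one _
  have h4 : 31 / 32 - 63 / 32 * μ.real E ≤ ∫ x, Real.cos (s * (x - A)) ∂μ := by
    have h5 := integral_mono ((integrable_const (31 / 32 : ℝ)).sub (hind.const_mul (63 / 32)))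
      hcos hlow
    simp only [Pi.sub_apply] at h5
    rw [integral_sub (integrable_const _) (hind.const_mul _), integral_const_mul,
      integral_indicator_const _ hEm] at h5
    simpa using h5
  rw [hnorm]
  have h6 := (le_abs_self _).trans (Complex.abs_re_le_norm
    (∫ x, Complex.exp (((s * (x - A) : ℝ) : ℂ) * Complex.I) ∂μ))
  rw [hre] at h6
  linarith

/-- The squared modulus of a characteristic function is the characteristic function of the
symmetrized law. -/
lemma norm_charFun_sq {μ : Measure ℝ} [IsProbabilityMeasure μ] (s : ℝ) :
    ‖charFun μ s‖ ^ 2 = ∫ z : ℝ × ℝ, Real.cos (s * (z.1 - z.2)) ∂μ.prod μ := by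
  have hint : Integrable (fun x : ℝ => Complex.exp (s * x * Complex.I)) μ := by
    refine Integrable.of_bound (by fun_prop) 1 (ae_of_all _ fun x => ?_)
    rw [← Complex.ofReal_mul, Complex.norm_exp_ofReal_mul_I]
  have hre : (charFun μ s).re = ∫ x, Real.cos (s * x) ∂μ := by
    have h1 := integral_re hint
    simp only [RCLike.re_to_complex, ← Complex.ofReal_mul, Complex.exp_ofReal_mul_I_re] at h1
    rw [h1, charFun_apply_real]
    simp
  have him : (charFun μ s).im = ∫ x, Real.sin (s * x) ∂μ := by
    have h1 := integral_im hint
    simp only [RCLike.im_to_complex, ← Complex.ofReal_mul, Complex.exp_ofReal_mul_I_im] at h1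
    rw [h1, charFun_apply_real]
    simp
  have hc : Integrable (fun x => Real.cos (s * x)) μ :=
    integrable_of_bounded (by fun_prop) fun x => Real.abs_cos_le_one _
  have hs : Integrable (fun x => Real.sin (s * x)) μ :=
    integrable_of_bounded (by fun_prop) fun x => Real.abs_sin_le_one _
  rw [Complex.sq_norm, Complex.normSq_apply, hre, him, ← integral_prod_mul, ← integral_prod_mul,
    ← integral_add (hc.mul_prod hc) (hs.mul_prod hs)]
  refine integral_congr_ae (ae_of_all _ fun z => ?_)
  simp only
  rw [mul_sub, Real.cos_sub]

/-- Near the origin, the modulus of the characteristic function of a nondegenerate law is bounded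
away from `1` by a multiple of `s ^ 2`, whether or not the variance is finite. -/
lemma exists_norm_charFun_sq_le {μ : Measure ℝ} [IsProbabilityMeasure μ]
    (hμ : ∀ c, ¬ ∀ᵐ x ∂μ, x = c) :
    ∃ c > 0, ∃ δ > 0, ∀ s, |s| ≤ δ → ‖charFun μ s‖ ^ 2 ≤ 1 - c * s ^ 2 := by
  set E : ℕ → Set (ℝ × ℝ) := fun L => {z | |z.1 - z.2| ≤ L} with hE
  have hEm : ∀ L, MeasurableSet (E L) := fun L =>
    measurableSet_le (by fun_prop) measurable_const
  set f : ℕ → ℝ × ℝ → ℝ := fun L => (E L).indicator fun z => (z.1 - z.2) ^ 2 with hf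
  have hf0 : ∀ L, 0 ≤ f L := fun L z => Set.indicator_nonneg (fun z _ => sq_nonneg _) z
  have hfi : ∀ L, Integrable (f L) (μ.prod μ) := fun L => by
    refine integrable_of_bounded ((by fun_prop : Measurable fun z : ℝ × ℝ =>
      (z.1 - z.2) ^ 2).indicator (hEm L)) (C := (L : ℝ) ^ 2) fun z => ?_
    rw [abs_of_nonneg (hf0 L z)]
    simp only [hf]
    by_cases hz : z ∈ E L
    · rw [Set.indicator_of_mem hz, ← sq_abs]
      exact pow_le_pow_left₀ (abs_nonneg _) hz 2
    · rw [Set.indicator_of_notMem hz]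
      positivity
  obtain ⟨L, hL⟩ : ∃ L : ℕ, 0 < ∫ z, f L z ∂μ.prod μ := by
    by_contra! hcon
    have h1 : ∀ L, f L =ᵐ[μ.prod μ] 0 := fun L =>
      (integral_eq_zero_iff_of_nonneg (hf0 L) (hfi L)).1
        (le_antisymm (hcon L) (integral_nonneg (hf0 L)))
    have h2 : ∀ᵐ z ∂μ.prod μ, z.1 = z.2 := by
      filter_upwards [ae_all_iff.2 h1] with z hz
      have h3 := hz ⌈|z.1 - z.2|⌉₊
      simp only [hf] at h3
      rw [Set.indicator_of_mem (show z ∈ E ⌈|z.1 - z.2|⌉₊ from Nat.le_ceil |z.1 - z.2|)] at h3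
      simpa [sub_eq_zero] using h3
    obtain ⟨c, hc⟩ := (Measure.ae_ae_of_ae_prod h2).exists
    exact hμ c (hc.mono fun x hx => hx.symm)
  refine ⟨2 / Real.pi ^ 2 * ∫ z, f L z ∂μ.prod μ, by positivity, Real.pi / (L + 1),
    by positivity, fun s hs => ?_⟩
  rw [norm_charFun_sq]
  have hpt : ∀ z : ℝ × ℝ, Real.cos (s * (z.1 - z.2)) ≤ 1 - 2 / Real.pi ^ 2 * s ^ 2 * f L z := by
    intro z
    by_cases hz : z ∈ E L
    · simp only [hf]
      rw [Set.indicator_of_mem hz, mul_assoc, ← mul_pow]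
      refine Real.cos_le_one_sub_mul_cos_sq ?_
      have hz' : |z.1 - z.2| ≤ L + 1 := (show |z.1 - z.2| ≤ L from hz).trans (by linarith)
      rw [abs_mul]
      calc |s| * |z.1 - z.2| ≤ Real.pi / (L + 1) * (L + 1) := by gcongr
        _ = Real.pi := by field_simp
    · simp only [hf]
      rw [Set.indicator_of_notMem hz, mul_zero, sub_zero]
      exact Real.cos_le_one _
  have hcos : Integrable (fun z : ℝ × ℝ => Real.cos (s * (z.1 - z.2))) (μ.prod μ) :=
    integrable_of_bounded (by fun_prop) fun x => Real.abs_cos_le_one _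
  have h1 := integral_mono hcos ((integrable_const (1 : ℝ)).sub ((hfi L).const_mul _)) hpt
  simp only [Pi.sub_apply] at h1
  rw [integral_sub (integrable_const _) ((hfi L).const_mul _), integral_const_mul] at h1
  simp only [integral_const, probReal_univ, one_smul] at h1
  linarith

variable {Ω : Type*} [MeasurableSpace Ω] {P : Measure Ω} {Y : ℕ → Ω → ℝ} {A B : ℕ → ℝ}

lemma measurable_partialSum (hY : ∀ i, Measurable (Y i)) (n : ℕ) : Measurable (partialSum Y n) := by
  unfold partialSum
  fun_prop

lemma norm_charFun_partialSum (hY : ∀ i, Measurable (Y i)) (hindep : iIndepFun Y P)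
    (hident : ∀ i, IdentDistrib (Y i) (Y 0) P P) (n : ℕ) (s : ℝ) :
    ‖charFun (P.map (partialSum Y n)) s‖ = ‖charFun (P.map (Y 0)) s‖ ^ n := by
  have h0 : iIndepFun (fun i : Finset.range n => Y i) P := hindep.precomp Subtype.val_injective
  have h1 := iIndepFun.charFun_map_fun_finsetSum_eq_prod (X := Y) (s := Finset.range n)
    (fun i _ => (hY i).aemeasurable) h0
  have h2 := congrFun h1 s
  have h3 : charFun (P.map (partialSum Y n)) s =
      ∏ i ∈ Finset.range n, charFun (P.map (Y i)) s := by
    change charFun (P.map fun ω => ∑ i ∈ Finset.range n, Y i ω) s = _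
    simpa only [Finset.prod_apply] using h2
  rw [h3, Finset.prod_congr rfl fun i _ => by rw [(hident i).map_eq]]
  simp

variable [IsProbabilityMeasure P]

lemma IsNormalNorming.tendsto_measure (h : IsNormalNorming P Y A B) (hY : ∀ i, Measurable (Y i))
    {s : Set ℝ} (hs : MeasurableSet s) (hfr : (frontier s).Countable) :
    Tendsto (fun n => P.real {ω | (partialSum Y n ω - A n) / B n ∈ s}) atTop
      (𝓝 ((gaussianReal 0 1).real s)) := by
  have h1 := ProbabilityMeasure.tendsto_measure_of_null_frontier_of_tendsto' h.2.tendsto (E := s) ?_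
  · simp only [ProbabilityMeasure.coe_mk, Measure.map_id] at h1
    have h2 := (ENNReal.tendsto_toReal (measure_ne_top _ _)).comp h1
    refine h2.congr fun n => ?_
    have := measurable_partialSum hY n
    rw [Function.comp_apply, Measure.map_apply (by fun_prop) hs]
    rfl
  · simp only [ProbabilityMeasure.coe_mk, Measure.map_id]
    have : NullSingletonClass (gaussianReal 0 1) := nullSingletonClass_gaussianReal one_ne_zero
    exact hfr.measure_zero _

/-- Summands whose normed sums are asymptotically normal are not almost surely constant. -/
lemma IsNormalNorming.not_ae_const (h : IsNormalNorming P Y A B) (hY : ∀ i, Measurable (Y i))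
    (hident : ∀ i, IdentDistrib (Y i) (Y 0) P P) (c : ℝ) : ¬ ∀ᵐ x ∂P.map (Y 0), x = c := by
  intro hc
  have hall : ∀ᵐ ω ∂P, ∀ i, Y i ω = c := by
    refine ae_all_iff.2 fun i => ?_
    rw [← (hident i).map_eq] at hc
    exact ae_of_ae_map (hY i).aemeasurable hc
  -- the normed sum is almost surely constant, so that its law gives every set mass `0` or `1`
  have key : ∀ s : Set ℝ, MeasurableSet s → (frontier s).Countable →
      (gaussianReal 0 1).real s ∈ ({0, 1} : Set ℝ) := by
    intro s hs hfr
    refine IsClosed.mem_of_tendsto (Set.Finite.isClosed (by simp))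
      (h.tendsto_measure hY hs hfr) (Eventually.of_forall fun n => ?_)
    by_cases hn : ((n : ℝ) * c - A n) / B n ∈ s
    · right
      rw [Set.mem_singleton_iff, measureReal_def, ENNReal.toReal_eq_one_iff, ← mem_ae_iff_prob_eq_one₀]
      · filter_upwards [hall] with ω hω
        simpa [partialSum, hω] using hn
      · have := measurable_partialSum hY n
        exact ((by fun_prop : Measurable fun ω => (partialSum Y n ω - A n) / B n)
          hs).nullMeasurableSet
    · left
      rw [measureReal_def, ENNReal.toReal_eq_zero_iff]
      left
      refine measure_mono_null (t := {ω | ¬ ∀ i, Y i ω = c}) (fun ω hω hω' => hn ?_) hall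
      simpa [partialSum, hω'] using hω
  have hpos : ∀ s : Set ℝ, IsOpen s → s.Nonempty → 0 < (gaussianReal 0 1).real s := by
    intro s hs hne
    rw [measureReal_def, ENNReal.toReal_pos_iff]
    refine ⟨pos_iff_ne_zero.2 fun h0 => ?_, measure_lt_top _ _⟩
    exact (hs.measure_pos volume hne).ne'
      (gaussianReal_absolutelyContinuous' 0 one_ne_zero h0)
  have h1 := key (Set.Ioi 0) measurableSet_Ioi (by simp)
  have h2 := hpos (Set.Ioi 0) isOpen_Ioi ⟨1, by simp⟩
  have h3 := hpos (Set.Iio 0) isOpen_Iio ⟨-1, by simp⟩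
  have h4 : (gaussianReal 0 1).real (Set.Iio 0) + (gaussianReal 0 1).real (Set.Ioi 0) ≤ 1 := by
    rw [← measureReal_union (by
      rw [Set.disjoint_left]; intro x h h'; simp at h h'; linarith) measurableSet_Ioi]
    exact measureReal_le_one
  rcases h1 with h1 | h1
  · linarith
  · rw [Set.mem_singleton_iff] at h1
    linarith

/-- The norming constants of an asymptotically normal i.i.d. sum are at least of order `√n`: the
modulus of the characteristic function of the sum at a frequency of order `1 / B n` stays away from
zero, and near the origin it is at most `(1 - c s ^ 2) ^ (n / 2)`. -/
theorem IsNormalNorming.exists_sqrt_le (h : IsNormalNorming P Y A B) (hY : ∀ i, Measurable (Y i))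
    (hindep : iIndepFun Y P) (hident : ∀ i, IdentDistrib (Y i) (Y 0) P P) :
    ∃ c > 0, ∀ᶠ n : ℕ in atTop, c * √n ≤ B n := by
  have : IsProbabilityMeasure (P.map (Y 0)) := Measure.isProbabilityMeasure_map (hY 0).aemeasurable
  obtain ⟨c, hc, δ, hδ, hφ⟩ := exists_norm_charFun_sq_le (h.not_ae_const hY hident)
  -- by Chebyshev's inequality a standard normal variable lies in `[-3, 3]` with probability `> 7 / 8`
  have hM : (gaussianReal 0 1).real (Set.Icc (-3) 3)ᶜ < 1 / 8 := by
    have h1 := meas_ge_le_variance_div_sq (memLp_id_gaussianReal (μ := 0) (v := 1) 2)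
      (by norm_num : (0 : ℝ) < 3)
    simp only [id_eq, integral_id_gaussianReal, sub_zero, variance_id_gaussianReal] at h1
    have h2 : (gaussianReal 0 1).real {x : ℝ | 3 ≤ |x|} ≤ 1 / 9 := by
      refine ENNReal.toReal_le_of_le_ofReal (by norm_num) (h1.trans_eq ?_)
      norm_num
    refine (measureReal_mono ?_).trans_lt (h2.trans_lt (by norm_num))
    intro x hx
    by_contra hcon
    exact hx (abs_le.1 (not_le.1 hcon).le)
  have hlim := h.tendsto_measure hY (s := (Set.Icc (-3) 3)ᶜ) measurableSet_Icc.compl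
    (by rw [frontier_compl, frontier_Icc (by norm_num)]; exact (Set.toFinite _).countable)
  refine ⟨√(c / 432), by positivity, ?_⟩
  filter_upwards [hlim.eventually_lt_const hM, eventually_ge_atTop 1,
    eventually_gt_atTop ⌈3 / (c * δ ^ 2)⌉₊] with n hn hn1 hn2
  have hB : 0 < B n := h.1 n hn1
  have hSm := measurable_partialSum hY n
  have : IsProbabilityMeasure (P.map (partialSum Y n)) :=
    Measure.isProbabilityMeasure_map hSm.aemeasurable
  have htail : (P.map (partialSum Y n)).real {x | 3 * B n < |x - A n|} ≤ 1 / 8 := by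
    rw [map_measureReal_apply hSm (measurableSet_lt measurable_const (by fun_prop))]
    refine (measureReal_mono ?_).trans hn.le
    intro ω hω hcon
    have h1 : |(partialSum Y n ω - A n) / B n| ≤ 3 := abs_le.2 hcon
    rw [abs_div, abs_of_pos hB, div_le_iff₀ hB] at h1
    exact absurd h1 (not_le.2 hω)
  set s : ℝ := min δ (1 / (12 * B n)) with hs
  have hs0 : 0 < s := lt_min hδ (by positivity)
  have hsR : |s| * (3 * B n) ≤ 1 / 4 := by
    rw [abs_of_pos hs0]
    calc s * (3 * B n) ≤ 1 / (12 * B n) * (3 * B n) := by gcongr; exact min_le_right _ _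
      _ = 1 / 4 := by field_simp; norm_num
  have h1 := half_le_norm_charFun htail hsR
  rw [norm_charFun_partialSum hY hindep hident] at h1
  have h2 := hφ s (by rw [abs_of_pos hs0]; exact min_le_left _ _)
  have h3 : (1 / 2 : ℝ) ^ 2 ≤ Real.exp (-(n * (c * s ^ 2))) := by
    calc (1 / 2 : ℝ) ^ 2 ≤ (‖charFun (P.map (Y 0)) s‖ ^ n) ^ 2 := by gcongr
      _ = (‖charFun (P.map (Y 0)) s‖ ^ 2) ^ n := by ring
      _ ≤ Real.exp (-(c * s ^ 2)) ^ n := by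
        gcongr
        exact h2.trans (Real.one_sub_le_exp_neg _)
      _ = _ := by rw [← Real.exp_nat_mul]; ring_nf
  have h4 : n * (c * s ^ 2) ≤ 3 := by
    rw [Real.exp_neg] at h3
    have h5 := Real.add_one_le_exp (n * (c * s ^ 2))
    have h6 : Real.exp (n * (c * s ^ 2)) ≤ 4 := by
      have := inv_anti₀ (by norm_num) h3
      rw [inv_inv] at this
      norm_num at this
      exact this
    linarith
  have h7 : s = 1 / (12 * B n) := by
    rcases min_choice δ (1 / (12 * B n)) with h8 | h8
    · exfalso
      rw [hs, h8] at h4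
      have h9 : 3 / (c * δ ^ 2) < n := Nat.lt_of_ceil_lt hn2
      rw [div_lt_iff₀ (by positivity)] at h9
      linarith
    · exact h8
  rw [h7] at h4
  rw [← Real.sqrt_mul (by positivity), Real.sqrt_le_left hB.le]
  have h8 : (n : ℝ) * (c * (1 / (12 * B n)) ^ 2) = c / 144 * n / B n ^ 2 := by
    field_simp
    norm_num
  rw [h8, div_le_iff₀ (by positivity)] at h4
  linarith

/-- The self-normalizer of an i.i.d. sequence that does not vanish is at least of order `√n`, by the
law of large numbers for the truncated squares. -/
theorem exists_tendsto_measure_sqrt_sum_sq_lt (hY : ∀ i, Measurable (Y i)) (hindep : iIndepFun Y P)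
    (hident : ∀ i, IdentDistrib (Y i) (Y 0) P P) (h0 : ¬ ∀ᵐ ω ∂P, Y 0 ω = 0) :
    ∃ c > 0, Tendsto (fun n : ℕ => P {ω | √(∑ i ∈ Finset.range n, Y i ω ^ 2) < c * √n})
      atTop (𝓝 0) := by
  let f : ℝ → ℝ := fun y => min (y ^ 2) 1
  have hf : Measurable f := by fun_prop
  have hf0 : ∀ y, 0 ≤ f y := fun y => le_min (sq_nonneg y) zero_le_one
  have hfi : Integrable (fun ω => f (Y 0 ω)) P :=
    integrable_of_bounded (hf.comp (hY 0)) (C := 1) fun ω => by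
      rw [abs_of_nonneg (hf0 _)]; exact min_le_right _ _
  have hpos : 0 < ∫ ω, f (Y 0 ω) ∂P := by
    rw [integral_pos_iff_support_of_nonneg (fun ω => hf0 _) hfi, pos_iff_ne_zero]
    intro hz
    refine h0 ((ae_iff.2 ?_))
    convert hz using 2
    ext ω
    simp only [Set.mem_ofPred_eq, Function.mem_support, f, ne_eq]
    rw [not_iff_not]
    constructor
    · intro h; simp [h]
    · intro h
      rcases min_choice (Y 0 ω ^ 2) 1 with h1 | h1
      · rw [h1] at h
        exact pow_eq_zero_iff (by norm_num) |>.1 h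
      · rw [h1] at h
        exact absurd h one_ne_zero
  set e := ∫ ω, f (Y 0 ω) ∂P with he
  have hslln := strong_law_ae_real (μ := P) (fun i ω => f (Y i ω)) hfi
    (fun i j hij => (hindep.indepFun hij).comp hf hf) fun i => (hident i).comp hf
  refine ⟨√(e / 2), by positivity, ?_⟩
  have hmeas : ∀ n : ℕ, AEStronglyMeasurable
      (fun ω => (∑ i ∈ Finset.range n, f (Y i ω)) / n) P := fun n =>
    Measurable.aestronglyMeasurable
      ((Finset.measurable_fun_sum _ fun i _ => hf.comp (hY i)).div_const _)
  have htm := tendstoInMeasure_of_tendsto_ae hmeas hslln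
  rw [tendstoInMeasure_iff_norm] at htm
  refine tendsto_of_tendsto_of_tendsto_of_le_of_le' tendsto_const_nhds (htm (e / 2) (by positivity))
    (Eventually.of_forall fun n => zero_le) ?_
  filter_upwards [eventually_ge_atTop 1] with n hn
  refine measure_mono fun ω hω => ?_
  simp only [Set.mem_ofPred_eq] at hω ⊢
  have hn0 : (0 : ℝ) < n := by exact_mod_cast hn
  rw [← Real.sqrt_mul (by positivity), Real.sqrt_lt_sqrt_iff
    (Finset.sum_nonneg fun i _ => sq_nonneg _)] at hω
  have h1 : (∑ i ∈ Finset.range n, f (Y i ω)) / n < e / 2 := by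
    rw [div_lt_iff₀ hn0]
    exact (Finset.sum_le_sum fun i _ => min_le_left _ _).trans_lt hω
  rw [Real.norm_eq_abs, abs_sub_comm]
  refine le_trans ?_ (le_abs_self _)
  change e / 2 ≤ e - _
  linarith

end

/-! ### Uniform negligibility of the degenerate part -/

lemma tendsto_sum_div_sqrt {e : ℕ → ℝ} (he0 : ∀ k, 0 ≤ e k)
    (he : Tendsto (fun k : ℕ => √k * e k) atTop (𝓝 0)) :
    Tendsto (fun n : ℕ => (∑ k ∈ Finset.range n, e (k + 1)) / √n) atTop (𝓝 0) := by
  have hg : ∀ k : ℕ, 0 ≤ √((k + 1 : ℕ) : ℝ) - √(k : ℝ) := fun k =>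
    sub_nonneg.2 (Real.sqrt_le_sqrt (by push_cast; linarith))
  have hsum : ∀ n : ℕ, ∑ k ∈ Finset.range n, (√((k + 1 : ℕ) : ℝ) - √(k : ℝ)) = √n := fun n => by
    rw [Finset.sum_range_sub (fun k : ℕ => √(k : ℝ))]
    simp
  have hlo : (fun k => e (k + 1)) =o[atTop] fun k : ℕ => √((k + 1 : ℕ) : ℝ) - √(k : ℝ) := by
    rw [Asymptotics.isLittleO_iff]
    intro ε hε
    have h1 := ((tendsto_add_atTop_iff_nat 1).2 he).eventually_lt_const
      (show (0 : ℝ) < ε / 2 by positivity)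
    filter_upwards [h1] with k hk
    rw [Real.norm_of_nonneg (he0 _), Real.norm_of_nonneg (hg k)]
    set u := √((k + 1 : ℕ) : ℝ)
    set w := √(k : ℝ)
    have hu : 0 < u := Real.sqrt_pos.2 (by positivity)
    have hw : 0 ≤ w := Real.sqrt_nonneg _
    have hwu : w ≤ u := sub_nonneg.1 (hg k)
    have h2 : (u - w) * (u + w) = 1 := by
      have h3 : u ^ 2 = k + 1 := by
        rw [Real.sq_sqrt (by positivity)]; push_cast; ring
      have h4 : w ^ 2 = k := Real.sq_sqrt (by positivity)
      linarith [h3, h4, (by ring : (u - w) * (u + w) = u ^ 2 - w ^ 2)]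
    have h5 : (u + w) * e (k + 1) ≤ ε := by nlinarith [he0 (k + 1)]
    calc e (k + 1) = (u - w) * ((u + w) * e (k + 1)) := by rw [← mul_assoc, h2, one_mul]
      _ ≤ (u - w) * ε := mul_le_mul_of_nonneg_left h5 (hg k)
      _ = ε * (u - w) := mul_comm _ _
  have hinf : Tendsto (fun n : ℕ => √(n : ℝ)) atTop atTop :=
    Real.tendsto_sqrt_atTop.comp tendsto_natCast_atTop_atTop
  have h1 := hlo.sum_range hg (by simpa only [hsum] using hinf)
  simp only [hsum] at h1
  exact h1.tendsto_div_nhds_zero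

/-- The degenerate part of the U-process is uniformly `o(√n)` in probability. -/
theorem tendsto_measure_exists_le_abs_tupleAvg {F : Measure ℝ} [IsProbabilityMeasure F] {r : ℕ}
    {h : (Fin (r + 1) → ℝ) → ℝ}
    (h_symm : ∀ (σ : Equiv.Perm (Fin (r + 1))) x, h (x ∘ σ) = h x) (hm : Measurable h)
    (hi : Integrable h (tupleLaw F (r + 1)))
    (hi43 : Integrable (fun y => |h y| ^ (4 / 3 : ℝ)) (tupleLaw F (r + 1))) {b : ℝ} (hb : 0 < b) :
    Tendsto (fun n : ℕ => seqLaw F {x | ∃ k, r + 1 ≤ k ∧ k ≤ n ∧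
      b * √n ≤ k * |tupleAvg (degen F h) (Finset.range k) x|}) atTop (𝓝 0) := by
  set e : ℕ → ℝ := fun k => ∫ x, |tupleAvg (degen F h) (Finset.range k) x| ∂seqLaw F with he
  have he0 : ∀ k, 0 ≤ e k := fun k => integral_nonneg fun x => abs_nonneg _
  have hlim := tendsto_sum_div_sqrt he0 (tendsto_sqrt_mul_integral_abs_tupleAvg h_symm hm hi hi43)
  have hinf : Tendsto (fun n : ℕ => √(n : ℝ)) atTop atTop :=
    Real.tendsto_sqrt_atTop.comp tendsto_natCast_atTop_atTop
  have hlim2 : Tendsto (fun n : ℕ => b⁻¹ * (((r + 1 : ℕ) * e (r + 1)) / √n +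
      (∑ k ∈ Finset.range n, e (k + 1)) / √n)) atTop (𝓝 0) := by
    simpa using ((hinf.const_div_atTop _).add hlim).const_mul b⁻¹
  rw [← ENNReal.tendsto_toReal_iff (fun n => measure_ne_top _ _) ENNReal.zero_ne_top]
  refine squeeze_zero' (Eventually.of_forall fun n => ENNReal.toReal_nonneg) ?_ hlim2
  filter_upwards [eventually_ge_atTop (r + 1)] with n hn
  have hn0 : (0 : ℝ) < √n := Real.sqrt_pos.2 (by exact_mod_cast (show 0 < n by omega))
  have h1 := mul_measure_exists_le_sum (measurable_degen hm) (measurePreserving_perm_seqLaw F)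
    (integrable_tuple (integrable_degen hi)) hn (b * √n)
  have h2 : ∑ k ∈ Finset.Ioc (r + 1) n, e k ≤ ∑ k ∈ Finset.range n, e (k + 1) := by
    rw [← Finset.sum_image (s := Finset.range n) (g := fun k => k + 1) (f := e)
      (fun a _ b _ hab => by simpa using hab)]
    refine Finset.sum_le_sum_of_subset_of_nonneg (fun k hk => ?_) fun k _ _ => he0 k
    rw [Finset.mem_Ioc] at hk
    exact Finset.mem_image.2 ⟨k - 1, Finset.mem_range.2 (by omega), by omega⟩
  have h3 := h1.trans (add_le_add_right h2 _)
  rw [← add_div, inv_mul_eq_div, div_div, le_div_iff₀ (by positivity), ← measureReal_def]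
  linarith

/-! ### Comparison of the U-process with the partial sum process -/

section
variable {Ω : Type*} [MeasurableSpace Ω] {P : Measure Ω} {X : ℕ → Ω → ℝ}

lemma measurePreserving_seq (hX_meas : ∀ i, Measurable (X i)) (hX_indep : iIndepFun X P)
    (hX_ident : ∀ i, IdentDistrib (X i) (X 0) P P) [IsProbabilityMeasure (P.map (X 0))] :
    MeasurePreserving (fun ω i => X i ω) P (seqLaw (P.map (X 0))) := by
  refine ⟨by fun_prop, ?_⟩
  rw [hX_indep.map_fun_eq_infinitePi_map hX_meas]
  simp_rw [fun i => (hX_ident i).map_eq]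

variable [IsProbabilityMeasure P]

lemma measurable_proj {m : ℕ} {h : (Fin m → ℝ) → ℝ} (hm : Measurable h) :
    Measurable (proj P X h) := by
  have h1 : StronglyMeasurable fun z : ℝ × (Fin m → ℝ) => h z.2 - theta P X h :=
    ((hm.comp measurable_snd).sub_const _).stronglyMeasurable
  exact h1.integral_condDistrib.measurable

/-- The conditional distribution of the tuple given its first entry `x` is that of `x` followed by
independent observations, so that `h̃₁` is the centered mean over the other observations. -/
lemma proj_ae_eq (hX_meas : ∀ i, Measurable (X i)) (hX_indep : iIndepFun X P)
    (hX_ident : ∀ i, IdentDistrib (X i) (X 0) P P) [IsProbabilityMeasure (P.map (X 0))] {r : ℕ}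
    {h : (Fin (r + 1) → ℝ) → ℝ} (hm : Measurable h)
    (hi : Integrable h (tupleLaw (P.map (X 0)) (r + 1))) :
    ∀ᵐ x ∂P.map (X 0), proj P X h x = condMean (P.map (X 0)) h x - theta P X h := by
  set F := P.map (X 0) with hF
  let c : ℝ × (Fin r → ℝ) → (Fin (r + 1) → ℝ) := fun z => Fin.cons z.1 z.2
  have hc : Measurable c := measurable_cons r
  let κ : Kernel ℝ (Fin (r + 1) → ℝ) := (Kernel.id ×ₖ Kernel.const ℝ (tupleLaw F r)).map c
  have hκ : ∀ x, κ x = (tupleLaw F r).map fun t => c (x, t) := by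
    intro x
    simp only [κ]
    rw [Kernel.map_apply _ hc, Kernel.prod_apply, Kernel.id_apply, Kernel.const_apply,
      Measure.dirac_prod, Measure.map_map hc measurable_prodMk_left]
    rfl
  have hlaw : MeasurePreserving (fun ω (j : Fin (r + 1)) => X j ω) P (tupleLaw F (r + 1)) :=
    (measurePreserving_tuple F (i := fun j : Fin (r + 1) => (j : ℕ)) Fin.val_injective).comp
      (measurePreserving_seq hX_meas hX_indep hX_ident)
  have hjoint : P.map (fun ω => (X 0 ω, fun j : Fin (r + 1) => X j ω)) = F ⊗ₘ κ := by
    have h1 : P.map (fun ω => (X 0 ω, fun j : Fin (r + 1) => X j ω)) =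
        (F.prod (tupleLaw F r)).map fun z => (z.1, c z) := by
      have h2 : Measurable fun y : Fin (r + 1) → ℝ => (y 0, y) := by fun_prop
      have h3 : (fun ω => (X 0 ω, fun j : Fin (r + 1) => X j ω)) =
          (fun y : Fin (r + 1) → ℝ => (y 0, y)) ∘ fun ω (j : Fin (r + 1)) => X j ω := by
        funext ω; simp
      rw [h3, ← Measure.map_map h2 hlaw.measurable, hlaw.map_eq,
        ← (measurePreserving_cons F r).map_eq, Measure.map_map h2 (measurable_cons r)]
      rfl
    rw [h1]
    ext s hs
    have h4 : Measurable fun z : ℝ × (Fin r → ℝ) => (z.1, c z) := by fun_prop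
    rw [Measure.map_apply h4 hs, Measure.prod_apply (h4 hs), Measure.compProd_apply hs]
    refine lintegral_congr fun x => ?_
    rw [hκ, Measure.map_apply (by fun_prop) (measurable_prodMk_left hs)]
    rfl
  have hcond := condDistrib_ae_eq_of_measure_eq_compProd_of_measurable (hX_meas 0)
    hlaw.measurable hjoint
  filter_upwards [hcond, (integrable_cons hi).prod_right_ae] with x hx hxi
  unfold proj condMean
  rw [hx, hκ, integral_map (by fun_prop) (hm.sub_const _).aestronglyMeasurable]
  have hxi' : Integrable (fun t : Fin r → ℝ => h (Fin.cons x t)) (tupleLaw F r) := hxi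
  rw [integral_sub hxi' (integrable_const _)]
  simp

lemma supDist_le {m : ℕ} (hm : 1 ≤ m) {h : (Fin m → ℝ) → ℝ} {n : ℕ} (hn : 1 ≤ n) {c δ : ℝ}
    (hc : 0 < c) {ω : Ω} {W : ℕ → ℝ}
    (hW : ∀ k, m ≤ k → (k : ℝ) / m * (uStat X h k ω - theta P X h) -
      partialSum (fun i ω => proj P X h (X i ω)) k ω = k / m * W k)
    (hsmall : ∑ i ∈ Finset.range m, |proj P X h (X i ω)| ≤ δ * c)
    (hlarge : ∀ k, m ≤ k → k ≤ n → k * |W k| ≤ δ * c) :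
    supDist P X h c n ω ≤ δ := by
  have hn0 : (0 : ℝ) < n := by exact_mod_cast hn
  have hm1 : (1 : ℝ) ≤ m := by exact_mod_cast hm
  refine ciSup_le fun ⟨t, ht0, ht1⟩ => ?_
  simp only
  set k := ⌊(n : ℝ) * t⌋₊ with hk
  have hkn : k ≤ n := by
    refine Nat.floor_le_of_le ?_
    nlinarith
  unfold uProc
  rw [← hk]
  split_ifs with htm
  · have hkm : k < m := by
      rw [hk, Nat.floor_lt (by positivity), mul_comm]
      exact (lt_div_iff₀ hn0).1 htm
    rw [mul_zero, zero_sub, abs_neg, abs_div, abs_of_pos hc, div_le_iff₀ hc]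
    refine le_trans ?_ hsmall
    refine (Finset.abs_sum_le_sum_abs _ _).trans ?_
    exact Finset.sum_le_sum_of_subset_of_nonneg (Finset.range_mono hkm.le)
      fun _ _ _ => abs_nonneg _
  · have hmk : m ≤ k := by
      rw [hk]
      refine Nat.le_floor ?_
      rw [mul_comm]
      exact (div_le_iff₀ hn0).1 (not_lt.1 htm)
    rw [← mul_div_assoc, ← sub_div, hW k hmk, abs_div, abs_of_pos hc, div_le_iff₀ hc, abs_mul,
      abs_of_nonneg (by positivity)]
    refine le_trans ?_ (hlarge k hmk hkn)
    gcongr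
    exact div_le_self (by positivity) hm1

/-- The U-process and the partial sum process are uniformly close for every normalizer of order at
least `√n`. -/
theorem tendstoInMeasure_supDist (hX_meas : ∀ i, Measurable (X i)) (hX_indep : iIndepFun X P)
    (hX_ident : ∀ i, IdentDistrib (X i) (X 0) P P) [IsProbabilityMeasure (P.map (X 0))] {r : ℕ}
    {h : (Fin (r + 1) → ℝ) → ℝ} (hm : Measurable h)
    (h_symm : ∀ (σ : Equiv.Perm (Fin (r + 1))) x, h (x ∘ σ) = h x)
    (hi : Integrable h (tupleLaw (P.map (X 0)) (r + 1)))
    (hi43 : Integrable (fun y => |h y| ^ (4 / 3 : ℝ)) (tupleLaw (P.map (X 0)) (r + 1)))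
    {c : ℕ → Ω → ℝ} {a : ℝ} (ha : 0 < a)
    (hc : Tendsto (fun n : ℕ => P {ω | c n ω < a * √n}) atTop (𝓝 0)) :
    TendstoInMeasure P (fun n ω => supDist P X h (c n ω) n ω) atTop fun _ => (0 : ℝ) := by
  set F := P.map (X 0) with hF
  have hseq := measurePreserving_seq hX_meas hX_indep hX_ident
  rw [tendstoInMeasure_iff_norm]
  intro ε hε
  set b : ℝ := ε / 2 * a with hb
  have hb0 : 0 < b := by positivity
  set S : Ω → ℝ := fun ω => ∑ i ∈ Finset.range (r + 1), |proj P X h (X i ω)| with hS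
  have hSm : Measurable S := Finset.measurable_fun_sum _ fun i _ =>
    ((measurable_proj hm).comp (hX_meas i)).abs
  have hinf : Tendsto (fun n : ℕ => √(n : ℝ)) atTop atTop :=
    Real.tendsto_sqrt_atTop.comp tendsto_natCast_atTop_atTop
  have h1 : Tendsto (fun n : ℕ => P {ω | b ≤ ‖S ω / √n - 0‖}) atTop (𝓝 0) :=
    tendstoInMeasure_iff_norm.1 (tendstoInMeasure_of_tendsto_ae
      (fun n => (hSm.div_const _).aestronglyMeasurable)
      (ae_of_all _ fun ω => hinf.const_div_atTop _)) b hb0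
  have h2 := tendsto_measure_exists_le_abs_tupleAvg h_symm hm hi hi43 hb0
  have hfin := (hc.add h1).add h2
  rw [add_zero, add_zero] at hfin
  refine tendsto_of_tendsto_of_tendsto_of_le_of_le' tendsto_const_nhds hfin
    (Eventually.of_forall fun n => zero_le) ?_
  have hproj : ∀ᵐ ω ∂P, ∀ i, proj P X h (X i ω) = condMean F h (X i ω) - theta P X h := by
    refine ae_all_iff.2 fun i => ?_
    have h3 := proj_ae_eq hX_meas hX_indep hX_ident hm hi
    have h4 : MeasurePreserving (X i) P F := ⟨hX_meas i, (hX_ident i).map_eq⟩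
    exact h4.quasiMeasurePreserving.ae h3
  filter_upwards [eventually_ge_atTop 1] with n hn
  have hn0 : (0 : ℝ) < √n := Real.sqrt_pos.2 (by exact_mod_cast hn)
  set D : Set (ℕ → ℝ) := {x | ∃ k, r + 1 ≤ k ∧ k ≤ n ∧
    b * √n ≤ k * |tupleAvg (degen F h) (Finset.range k) x|} with hD
  have hDm : MeasurableSet D := by
    have : D = ⋃ k ∈ Finset.Icc (r + 1) n, {x | b * √n ≤
        k * |tupleAvg (degen F h) (Finset.range k) x|} := by
      ext x; simp [hD, and_assoc]
    rw [this]
    exact Finset.measurableSet_biUnion _ fun k _ => measurableSet_le measurable_const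
      ((measurable_tupleAvg (measurable_degen hm) _).abs.const_mul _)
  rw [← hseq.measure_preimage hDm.nullMeasurableSet]
  refine le_trans ?_ (add_le_add_left (measure_union_le _ _) _)
  refine le_trans ?_ (measure_union_le _ _)
  refine measure_mono_ae ?_
  filter_upwards [hproj] with ω hω hsup
  by_contra hcon
  have hcon' : ¬ ((c n ω < a * √n ∨ b ≤ ‖S ω / √n - 0‖) ∨ (fun i => X i ω) ∈ D) := hcon
  push Not at hcon'
  obtain ⟨⟨hca, hSb⟩, hDω⟩ := hcon'
  have hc0 : 0 < c n ω := lt_of_lt_of_le (by positivity) hca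
  have hbc : b * √n ≤ ε / 2 * c n ω := by
    rw [hb, mul_assoc]
    gcongr
  have hle : supDist P X h (c n ω) n ω ≤ ε / 2 := by
    refine supDist_le (Nat.succ_pos r) hn hc0
      (W := fun k => tupleAvg (degen F h) (Finset.range k) fun i => X i ω) ?_ ?_ ?_
    · intro k hk
      have hk0 : (0 : ℝ) < k := by exact_mod_cast (show 0 < k by omega)
      have h4 := tupleAvg_sub_linear h (theta P X h) (fun x => condMean F h x - theta P X h)
        (fun i => X i ω) (Nat.succ_pos r) hk
      have h5 : tupleAvg (degen F h) (Finset.range k) (fun i => X i ω) = _ := h4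
      simp only [h5, partialSum, hω, uStat_eq_tupleAvg X h_symm]
      field_simp
    · rw [sub_zero, Real.norm_eq_abs, abs_div, abs_of_pos hn0, div_lt_iff₀ hn0] at hSb
      exact ((le_abs_self _).trans hSb.le).trans hbc
    · intro k hk hkn
      by_contra hlt
      exact hDω ⟨k, hk, hkn, hbc.trans (not_le.1 hlt).le⟩
  have h0 : 0 ≤ supDist P X h (c n ω) n ω := Real.iSup_nonneg fun t => abs_nonneg _
  have hsup' : ε ≤ ‖supDist P X h (c n ω) n ω - 0‖ := hsup
  rw [sub_zero, Real.norm_of_nonneg h0] at hsup'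
  linarith

end

/-- Finiteness of `E |f| ^ (4 / 3) log |f|` implies that of `E |f| ^ (4 / 3)` and of `E |f|`. -/
lemma integrable_of_rpow_mul_log {α : Type*} [MeasurableSpace α] {μ : Measure α}
    [IsFiniteMeasure μ] {f : α → ℝ} (hf : Measurable f)
    (hint : Integrable (fun x => |f x| ^ (4 / 3 : ℝ) * Real.log |f x|) μ) :
    Integrable f μ ∧ Integrable (fun x => |f x| ^ (4 / 3 : ℝ)) μ := by
  have h1 : Integrable (fun x => |f x| ^ (4 / 3 : ℝ)) μ := by
    refine ((integrable_const (Real.exp 1 ^ (4 / 3 : ℝ))).add hint.abs).mono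
      (hf.abs.pow_const _).aestronglyMeasurable (ae_of_all _ fun x => ?_)
    have h0 : 0 ≤ |f x| ^ (4 / 3 : ℝ) := by positivity
    rw [Real.norm_of_nonneg h0]
    refine le_trans ?_ (le_abs_self _)
    simp only [Pi.add_apply]
    rcases le_total |f x| (Real.exp 1) with hle | hle
    · exact (Real.rpow_le_rpow (abs_nonneg _) hle (by norm_num)).trans
        (le_add_of_nonneg_right (abs_nonneg _))
    · have hlog : 1 ≤ Real.log |f x| := by
        rwa [Real.le_log_iff_exp_le (lt_of_lt_of_le (Real.exp_pos 1) hle)]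
      have h2 : |f x| ^ (4 / 3 : ℝ) ≤ |(|f x| ^ (4 / 3 : ℝ) * Real.log |f x|)| :=
        (le_mul_of_one_le_right h0 hlog).trans (le_abs_self _)
      have h3 : 0 ≤ Real.exp 1 ^ (4 / 3 : ℝ) := by positivity
      linarith
  refine ⟨((integrable_const (1 : ℝ)).add h1).mono hf.aestronglyMeasurable
    (ae_of_all _ fun x => ?_), h1⟩
  refine le_trans ?_ (le_abs_self _)
  simp only [Pi.add_apply, Real.norm_eq_abs]
  have h0 : 0 ≤ |f x| ^ (4 / 3 : ℝ) := by positivity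
  rcases le_total |f x| 1 with hle | hle
  · linarith
  · have := Real.rpow_le_rpow_of_exponent_le hle (show (1 : ℝ) ≤ 4 / 3 by norm_num)
    rw [Real.rpow_one] at this
    linarith

end UStatistic

theorem theorem3 {Ω : Type*} [MeasurableSpace Ω] (P : Measure Ω) [IsProbabilityMeasure P]
    (X : ℕ → Ω → ℝ) (hX_meas : ∀ i, Measurable (X i)) (hX_indep : iIndepFun X P)
    (hX_ident : ∀ i, IdentDistrib (X i) (X 0) P P)
    (m : ℕ) (hm : 1 ≤ m) (h : (Fin m → ℝ) → ℝ) (h_meas : Measurable h)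
    (h_symm : ∀ (σ : Equiv.Perm (Fin m)) (x : Fin m → ℝ), h (x ∘ σ) = h x)
    (h_moment : Integrable (fun ω => |h (fun j => X j ω)| ^ (4 / 3 : ℝ) *
      Real.log |h (fun j => X j ω)|) P)
    (h_dan : UStatistic.InDAN P (fun i ω => UStatistic.proj P X h (X i ω))) :
    TendstoInMeasure P
        (fun n ω => UStatistic.supDist P X h (UStatistic.selfNorm P X h n ω) n ω) atTop
        (fun _ => (0 : ℝ)) ∧
      ∀ A B : ℕ → ℝ,
        UStatistic.IsNormalNorming P (fun i ω => UStatistic.proj P X h (X i ω)) A B →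
        TendstoInMeasure P (fun n ω => UStatistic.supDist P X h (B n) n ω) atTop
          (fun _ => (0 : ℝ)) := by
  have : IsProbabilityMeasure (P.map (X 0)) :=
    Measure.isProbabilityMeasure_map (hX_meas 0).aemeasurable
  obtain ⟨r, rfl⟩ : ∃ r, m = r + 1 := ⟨m - 1, by omega⟩
  have hlaw : MeasurePreserving (fun ω (j : Fin (r + 1)) => X j ω) P
      (UStatistic.tupleLaw (P.map (X 0)) (r + 1)) :=
    (UStatistic.measurePreserving_tuple _ (i := fun j : Fin (r + 1) => (j : ℕ))
      Fin.val_injective).comp (UStatistic.measurePreserving_seq hX_meas hX_indep hX_ident)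
  have hmom : Integrable (fun y => |h y| ^ (4 / 3 : ℝ) * Real.log |h y|)
      (UStatistic.tupleLaw (P.map (X 0)) (r + 1)) :=
    (hlaw.integrable_comp (by fun_prop)).1 h_moment
  obtain ⟨hi, hi43⟩ := UStatistic.integrable_of_rpow_mul_log h_meas hmom
  have hp : Measurable (UStatistic.proj P X h) := UStatistic.measurable_proj h_meas
  have hY : ∀ i, Measurable fun ω => UStatistic.proj P X h (X i ω) := fun i =>
    hp.comp (hX_meas i)
  have hYindep : iIndepFun (fun i ω => UStatistic.proj P X h (X i ω)) P :=
    hX_indep.comp (fun _ => UStatistic.proj P X h) fun _ => hp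
  have hYident : ∀ i, IdentDistrib (fun ω => UStatistic.proj P X h (X i ω))
      (fun ω => UStatistic.proj P X h (X 0 ω)) P P := fun i => (hX_ident i).comp hp
  constructor
  · obtain ⟨A, B, hAB⟩ := h_dan
    have hne : ¬ ∀ᵐ ω ∂P, UStatistic.proj P X h (X 0 ω) = 0 := fun h0 =>
      hAB.not_ae_const hY hYident 0 ((ae_map_iff (hY 0).aemeasurable
        (measurableSet_singleton 0)).2 h0)
    obtain ⟨a, ha, hlim⟩ :=
      UStatistic.exists_tendsto_measure_sqrt_sum_sq_lt hY hYindep hYident hne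
    exact UStatistic.tendstoInMeasure_supDist hX_meas hX_indep hX_ident h_meas h_symm hi hi43
      ha hlim
  · intro A B hAB
    obtain ⟨a, ha, hlim⟩ := hAB.exists_sqrt_le hY hYindep hYident
    refine UStatistic.tendstoInMeasure_supDist hX_meas hX_indep hX_ident h_meas h_symm hi hi43
      (c := fun n _ => B n) ha (tendsto_const_nhds.congr' ?_)
    filter_upwards [hlim] with n hn
    simp [not_lt.2 hn]
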